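/- Let $n\ge 3$, let $I\subset\mathbb R$ be an open interval and let $a,k:I\to\mathbb R$ be smooth with $a>0$. Let $(r,\omega)$, with $r>0$ and $\omega\in\mathbb S^{n-1}$, be polar coordinates of $\mathbb R^n$, let $g_{\mathbb S}$ be the round metric of $\mathbb S^{n-1}$, and put $S_k(r)=\sin(\sqrt k\,r)/\sqrt k$, $r$, $\sinh(\sqrt{-k}\,r)/\sqrt{-k}$ for $k>0$, $k=0$, $k<0$ respectively. Consider on open subsets of $I\times\mathbb R^n$ (with $1/\sqrt C:=\infty$ for $C\le 0$) the Lorentzian metrics - (warped) $-dt^2+a(t)^2\big(dr^2+S_{k(t)}(r)^2 g_{\mathbb S}\big)$ on $0<r<\pi/\sqrt{k(t)}$; - (conformal) $-dt^2+\frac{4a(t)^2}{(1+k(t)r^2)^2}\big(dr^2+r^2 g_{\mathbb S}\big)$ on $0<r<1/\sqrt{-k(t)}$; - (radial) $-dt^2+a(t)^2\Big(\frac{dr^2}{1-k(t)r^2}+r^2 g_{\mathbb S}\Big)$ on $0<r<1/\sqrt{k(t)}$. Say that a scalar diverges at a boundary point $p$ of the domain if its absolute value tends to $\infty$ as the point of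 the domain tends to $p$ (in particular along $r\nearrow r_{\max}(t)$ at fixed $t$ and $\omega$); there is a curvature singularity at $p$ if the Ricci scalar diverges at $p$. For every $\omega\in\mathbb S^{n-1}$ the following hold. 1. Warped metric: for every $t\in I$ with $k(t)>0$ and $\dot k(t)\ne0$ there is a curvature singularity at $(t,\ r=\pi/\sqrt{k(t)},\ \omega)$. 2. Conformal metric: (a) for every $t\in I$ with $k(t)<0$ and $\dot k(t)\neq 0$ there is a curvature singularity at $(t,\ r=1/\sqrt{-k(t)},\ \omega)$. (b) For such $t$ and every $0<r_0<1/\sqrt{-k(t)}$, the length of the curve $r\mapsto(t,r,\omega)$, $r_0<r<1/\sqrt{-k(t)}$, is infinite. (c) If $t_0<t_1$ in $I$ and $k<0$, $\dot k<0$ on $[t_0,t_1]$, then $1/\sqrt{-k(t_1)}<1/\sqrt{-k(t_0)}$, and for every $r$ strictly between these two values the comoving observer $t\mapsto(t,r,\omega)$ starting at $t=t_0$ stays in the domain until some time $\tau\in(t_0,t_1)$, at which it reaches the curvature singularity; the elapsed proper time is $\tau-t_0<\infty$. 3. Radial metric: (a) for every $t\in I$ with $k(t)>0$ and $\dot k(t)\neq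 0$ both the Ricci scalar and $C_{abcd}C^{abcd}$ ($C$ the Weyl tensor) diverge at $(t,\ r=1/\sqrt{k(t)},\ \omega)$. (b) For such $t$ and every $0<r_0<1/\sqrt{k(t)}$, the length of the curve $r\mapsto(t,r,\omega)$, $r_0<r<1/\sqrt{k(t)}$, is finite. (c) If $t_0<t_1$ in $I$ and $k>0$, $\dot k>0$ on $[t_0,t_1]$, then $1/\sqrt{k(t_1)}<1/\sqrt{k(t_0)}$, and for every $r$ strictly between these two values the comoving observer $t\mapsto(t,r,\omega)$ starting at $t=t_0$ stays in the domain until some time $\tau\in(t_0,t_1)$, at which it reaches the curvature singularity; the elapsed proper time is $\tau-t_0<\infty$. -/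

import Mathlib

namespace KTCosmology

/-! Local tensor calculus for a (pseudo-Riemannian) metric given by its matrix of components
`g x i j` in coordinates `x = (x₀, …, xₙ)` of `ℝ^{n+1}`. -/

/-- The `i`-th partial derivative of `F`. -/
noncomputable def pd {N : ℕ} (i : Fin N) (F : (Fin N → ℝ) → ℝ) (x : Fin N → ℝ) : ℝ :=
  fderiv ℝ F x (Pi.single i 1)

/-- Christoffel symbols `Γ^l_{ij}` of the Levi-Civita connection of `g`. -/
noncomputable def christoffel {N : ℕ} (g : (Fin N → ℝ) → Matrix (Fin N) (Fin N) ℝ)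
    (l i j : Fin N) (x : Fin N → ℝ) : ℝ :=
  (1 / 2) * ∑ m, (g x)⁻¹ l m *
    (pd i (fun y => g y j m) x + pd j (fun y => g y i m) x - pd m (fun y => g y i j) x)

/-- The Riemann tensor `R^l_{kij} = ∂_i Γ^l_{jk} - ∂_j Γ^l_{ik} + Γ^l_{im} Γ^m_{jk}
- Γ^l_{jm} Γ^m_{ik}`. -/
noncomputable def riemannUp {N : ℕ} (g : (Fin N → ℝ) → Matrix (Fin N) (Fin N) ℝ)
    (l k i j : Fin N) (x : Fin N → ℝ) : ℝ :=
  pd i (christoffel g l j k) x - pd j (christoffel g l i k) x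
    + ∑ m, (christoffel g l i m x * christoffel g m j k x
        - christoffel g l j m x * christoffel g m i k x)

/-- The fully covariant Riemann tensor `R_{lkij}`. -/
noncomputable def riemann {N : ℕ} (g : (Fin N → ℝ) → Matrix (Fin N) (Fin N) ℝ)
    (l k i j : Fin N) (x : Fin N → ℝ) : ℝ :=
  ∑ m, g x l m * riemannUp g m k i j x

/-- The Ricci tensor `R_{kj} = R^l_{klj}`; it is `(N - 1) g` on the unit `N`-sphere. -/
noncomputable def ricci {N : ℕ} (g : (Fin N → ℝ) → Matrix (Fin N) (Fin N) ℝ)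
    (k j : Fin N) (x : Fin N → ℝ) : ℝ :=
  ∑ l, riemannUp g l k l j x

/-- The Ricci scalar `g^{kj} R_{kj}`. -/
noncomputable def ricciScalar {N : ℕ} (g : (Fin N → ℝ) → Matrix (Fin N) (Fin N) ℝ)
    (x : Fin N → ℝ) : ℝ :=
  ∑ k, ∑ j, (g x)⁻¹ k j * ricci g k j x

/-- The Weyl tensor `C_{abcd}` in dimension `N` (meaningful for `N ≥ 3`). -/
noncomputable def weyl {N : ℕ} (g : (Fin N → ℝ) → Matrix (Fin N) (Fin N) ℝ)
    (a b c d : Fin N) (x : Fin N → ℝ) : ℝ :=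
  riemann g a b c d x
    - 1 / ((N : ℝ) - 2) *
      (g x a c * ricci g b d x - g x a d * ricci g b c x
        - g x b c * ricci g a d x + g x b d * ricci g a c x)
    + ricciScalar g x / (((N : ℝ) - 1) * ((N : ℝ) - 2)) *
      (g x a c * g x b d - g x a d * g x b c)

/-- The scalar `C_{abcd} C^{abcd}`. -/
noncomputable def weylSquared {N : ℕ} (g : (Fin N → ℝ) → Matrix (Fin N) (Fin N) ℝ)
    (x : Fin N → ℝ) : ℝ :=
  ∑ a, ∑ b, ∑ c, ∑ d, ∑ a', ∑ b', ∑ c', ∑ d',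
    (g x)⁻¹ a a' * (g x)⁻¹ b b' * (g x)⁻¹ c c' * (g x)⁻¹ d d' *
      (weyl g a b c d x * weyl g a' b' c' d' x)

/-- The length `∫ √|g(γ', γ')|` of the part of the curve `γ` with parameter between `s₀` and `s₁`:
proper time if `γ` is timelike, spatial length if `γ` is spacelike. It may be infinite. -/
noncomputable def curveLength {N : ℕ} (g : (Fin N → ℝ) → Matrix (Fin N) (Fin N) ℝ)
    (γ : ℝ → Fin N → ℝ) (s₀ s₁ : ℝ) : ENNReal :=
  ∫⁻ s in Set.Ioo s₀ s₁,
    ENNReal.ofReal (Real.sqrt |∑ i, ∑ j, g (γ s) i j * deriv γ s i * deriv γ s j|)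

/-- `p` is a boundary point of the open domain `U`, and the absolute value of the scalar `S` on `U`
tends to infinity as the point of `U` tends to `p` in any way. -/
def DivergesAt {N : ℕ} (U : Set (Fin N → ℝ)) (S : (Fin N → ℝ) → ℝ) (p : Fin N → ℝ) : Prop :=
  p ∈ frontier U ∧ Filter.Tendsto (fun x => |S x|) (nhdsWithin p U) Filter.atTop

/-- The curve `γ`, starting at parameter `s₀`, stays in the domain `U` for parameters in `[s₀, s₁)`
and, as the parameter tends to `s₁`, converges to a point outside `U` at which the Ricci scalar
diverges. -/
def ReachesCurvatureSingularity {N : ℕ} (U : Set (Fin N → ℝ))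
    (g : (Fin N → ℝ) → Matrix (Fin N) (Fin N) ℝ) (γ : ℝ → Fin N → ℝ) (s₀ s₁ : ℝ) : Prop :=
  (∀ s ∈ Set.Ico s₀ s₁, γ s ∈ U) ∧
    ∃ p, p ∉ U ∧ Filter.Tendsto γ (nhdsWithin s₁ (Set.Iio s₁)) (nhds p) ∧
      DivergesAt U (ricciScalar g) p

/-! The three `k(t)` metrics, on open subsets of `I × ℝⁿ`. A point of `ℝ × ℝⁿ` is
`x : Fin (n + 1) → ℝ`, where `x 0 = t` and the other entries are the Cartesian coordinates
on `ℝⁿ`. -/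

/-- The radius `r` on `ℝⁿ`. -/
noncomputable def rad {n : ℕ} (x : Fin (n + 1) → ℝ) : ℝ :=
  Real.sqrt (∑ i : Fin n, x i.succ ^ 2)

/-- The point with time `t`, radius `r` and direction `ω` (a unit vector of `ℝⁿ`). -/
def event {n : ℕ} (ω : Fin n → ℝ) (t r : ℝ) : Fin (n + 1) → ℝ :=
  Fin.cons t (fun i => r * ω i)

/-- The components of the one-form `dt`. -/
def dt {n : ℕ} (i : Fin (n + 1)) : ℝ := if i = 0 then 1 else 0

/-- The components of the one-form `dr`, that is `∂_i r = xᵢ / r` for a spatial index. -/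
noncomputable def dr {n : ℕ} (x : Fin (n + 1) → ℝ) (i : Fin (n + 1)) : ℝ :=
  if i = 0 then 0 else x i / rad x

/-- The components of the round metric of the unit sphere `S^{n-1}` in polar coordinates:
the Euclidean metric of `ℝⁿ` is `dr² + r² g_S`. -/
noncomputable def roundMetric {n : ℕ} (x : Fin (n + 1) → ℝ) (i j : Fin (n + 1)) : ℝ :=
  ((if i = j ∧ i ≠ 0 then 1 else 0) - dr x i * dr x j) / rad x ^ 2

/-- The metric `-dt² + W(t,r)² dr² + f(t,r)² g_S`. -/
noncomputable def sphericalMetric (n : ℕ) (W f : ℝ → ℝ → ℝ) (x : Fin (n + 1) → ℝ) :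
    Matrix (Fin (n + 1)) (Fin (n + 1)) ℝ :=
  Matrix.of fun i j =>
    -(dt i * dt j) + W (x 0) (rad x) ^ 2 * (dr x i * dr x j)
      + f (x 0) (rad x) ^ 2 * roundMetric x i j

/-- The function `S_k(r)`. -/
noncomputable def sk (k r : ℝ) : ℝ :=
  if 0 < k then Real.sin (Real.sqrt k * r) / Real.sqrt k
  else if k = 0 then r
  else Real.sinh (Real.sqrt (-k) * r) / Real.sqrt (-k)

/-- `-dt² + a² (dr² + S_k(r)² g_S)`. -/
noncomputable def warpedMetric (n : ℕ) (a k : ℝ → ℝ) :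
    (Fin (n + 1) → ℝ) → Matrix (Fin (n + 1)) (Fin (n + 1)) ℝ :=
  sphericalMetric n (fun t _ => a t) (fun t r => a t * sk (k t) r)

/-- `-dt² + 4 a² / (1 + k r²)² (dr² + r² g_S)`. -/
noncomputable def conformalMetric (n : ℕ) (a k : ℝ → ℝ) :
    (Fin (n + 1) → ℝ) → Matrix (Fin (n + 1)) (Fin (n + 1)) ℝ :=
  sphericalMetric n (fun t r => 2 * a t / (1 + k t * r ^ 2))
    (fun t r => 2 * a t / (1 + k t * r ^ 2) * r)

/-- `-dt² + a² (dr² / (1 - k r²) + r² g_S)`. -/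
noncomputable def radialMetric (n : ℕ) (a k : ℝ → ℝ) :
    (Fin (n + 1) → ℝ) → Matrix (Fin (n + 1)) (Fin (n + 1)) ℝ :=
  sphericalMetric n (fun t r => a t / Real.sqrt (1 - k t * r ^ 2)) (fun t r => a t * r)

/-- `c / √C`, with the convention that it is `∞` when `C ≤ 0`. -/
noncomputable def divSqrt (c C : ℝ) : EReal :=
  if 0 < C then ((c / Real.sqrt C : ℝ) : EReal) else ⊤

/-- `t ∈ I`, `0 < r < π / √k(t)`. -/
def warpedDomain (n : ℕ) (I : Set ℝ) (k : ℝ → ℝ) : Set (Fin (n + 1) → ℝ) :=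
  {x | x 0 ∈ I ∧ 0 < rad x ∧ (rad x : EReal) < divSqrt Real.pi (k (x 0))}

/-- `t ∈ I`, `0 < r < 1 / √(-k(t))`. -/
def conformalDomain (n : ℕ) (I : Set ℝ) (k : ℝ → ℝ) : Set (Fin (n + 1) → ℝ) :=
  {x | x 0 ∈ I ∧ 0 < rad x ∧ (rad x : EReal) < divSqrt 1 (-k (x 0))}

/-- `t ∈ I`, `0 < r < 1 / √k(t)`. -/
def radialDomain (n : ℕ) (I : Set ℝ) (k : ℝ → ℝ) : Set (Fin (n + 1) → ℝ) :=
  {x | x 0 ∈ I ∧ 0 < rad x ∧ (rad x : EReal) < divSqrt 1 (k (x 0))}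

end KTCosmology

/-! ### Algebra of the splitting into time, radial and angular directions -/

namespace KTCosmology

open Topology

/-! All three metrics have the form `-dt² + W² dr² + f² g_S`. In Cartesian components put τ = dt, ν
= dr and let σ be the angular projection. Every tensor that occurs is a polynomial in τ, ν, σ with
scalar coefficients, and differentiation preserves this form because ∂ν = σ / r (`hasPD_dr`). Index
sums then reduce to the relations in `IsSplitting`, and the curvature is computed for general W and
f. With K = W_tt/W, P = f_tt/f, G the radial Hessian component of f divided by f, and Φ = (1 -
|∇f|²)/f², the results are R = 2K + 2(n-1)(P - G/W²) + (n-1)(n-2)Φ and C² = 4(n-2)/n · (K - P + G/W²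
+ Φ)² (`ricciScalar_sphericalMetric`, `weylSquared_sphericalMetric`).

For each metric the scalar is then M / D² with D → 0 at the boundary point and M continuous and
nonzero there, so `divergesAt_of_eq_div` gives divergence along every approach. What keeps M from
vanishing is the time dependence of the boundary. Radial: with D = 1 - k r², differentiating
D^(-1/2) twice in time leaves 3/4 k'² r⁴ / D² in K, and every other term is of lower order; the Weyl
scalar is of order D⁻⁴. Conformal: with D = 1 + k r² several terms have order D⁻², and their
coefficients add up to n(n+3) k'² r⁴. Warped: at r = π/√k the sphere closes up, f = 0 and f_r² = a²,
so the static part of Φ cancels in M, but f_t = -a k' r / (2k) does not vanish there.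

Radial lengths are the integrals of |W|: an arcsine in the radial case, a nonintegrable 1/(R - s) in
the conformal case. Comoving curves have unit speed, and the shrinking boundary radius meets them by
the intermediate value theorem (`exists_crossing`). -/

/-- The angular projection `δ_{ij} - ∂_i r ∂_j r` on spatial indices. -/
noncomputable def angProj {n : ℕ} (x : Fin (n + 1) → ℝ) (i j : Fin (n + 1)) : ℝ :=
  (if i = j ∧ i ≠ 0 then 1 else 0) - dr x i * dr x j

/-- Two unit covectors `τ`, `ν` and a symmetric projection `σ` of trace `m` that are mutually
orthogonal and add up to the identity. -/
structure IsSplitting {N : ℕ} (τ ν : Fin N → ℝ) (σ : Fin N → Fin N → ℝ) (m : ℝ) : Prop where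
  symm : ∀ i j, σ i j = σ j i
  sum_tt : ∑ l, τ l * τ l = 1
  sum_nn : ∑ l, ν l * ν l = 1
  sum_tn : ∑ l, τ l * ν l = 0
  sum_ts : ∀ i, ∑ l, τ l * σ i l = 0
  sum_ns : ∀ i, ∑ l, ν l * σ i l = 0
  sum_ss : ∀ i j, ∑ l, σ i l * σ j l = σ i j
  trace : ∑ l, σ l l = m
  one : ∀ i j, (if i = j then 1 else 0) = τ i * τ j + ν i * ν j + σ i j

lemma rad_sq {n : ℕ} (x : Fin (n + 1) → ℝ) : rad x ^ 2 = ∑ i : Fin n, x i.succ ^ 2 :=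
  Real.sq_sqrt (Finset.sum_nonneg fun _ _ => sq_nonneg _)

@[simp] lemma dr_zero {n : ℕ} (x : Fin (n + 1) → ℝ) : dr x 0 = 0 := by simp [dr]

lemma dr_succ {n : ℕ} (x : Fin (n + 1) → ℝ) (i : Fin n) : dr x i.succ = x i.succ / rad x := by
  simp [dr, Fin.succ_ne_zero]

@[simp] lemma dt_zero {n : ℕ} : dt (0 : Fin (n + 1)) = 1 := by simp [dt]

@[simp] lemma dt_succ {n : ℕ} (i : Fin n) : dt i.succ = 0 := by simp [dt, Fin.succ_ne_zero]

lemma sum_dr_mul_dr {n : ℕ} {x : Fin (n + 1) → ℝ} (hx : rad x ≠ 0) :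
    ∑ l, dr x l * dr x l = 1 := by
  rw [Fin.sum_univ_succ]
  simp only [dr_zero, dr_succ]
  have : ∀ i : Fin n, x i.succ / rad x * (x i.succ / rad x) = x i.succ ^ 2 * (rad x ^ 2)⁻¹ :=
    fun i => by field_simp
  simp_rw [this]
  rw [← Finset.sum_mul, ← rad_sq]
  field_simp
  simp

lemma sum_spatial {n : ℕ} (u : Fin (n + 1) → ℝ) (hu : u 0 = 0) (i : Fin (n + 1)) :
    ∑ l, u l * (if i = l ∧ i ≠ 0 then 1 else 0) = u i := by
  by_cases hi : i = 0
  · simp [hi, hu]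
  · simp [hi]

lemma isSplitting {n : ℕ} {x : Fin (n + 1) → ℝ} (hx : rad x ≠ 0) :
    IsSplitting dt (dr x) (angProj x) ((n : ℝ) - 1) where
  symm i j := by
    unfold angProj
    rw [mul_comm (dr x i)]
    congr 1
    by_cases h : i = j
    · simp [h]
    · simp [h, Ne.symm h]
  sum_tt := by simp [Fin.sum_univ_succ]
  sum_nn := sum_dr_mul_dr hx
  sum_tn := by simp [Fin.sum_univ_succ]
  sum_ts i := by
    simp only [Fin.sum_univ_succ, dt_zero, dt_succ, zero_mul, Finset.sum_const_zero, angProj,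
      dr_zero]
    by_cases h : i = 0 <;> simp [h]
  sum_ns i := by
    simp only [angProj, mul_sub, Finset.sum_sub_distrib]
    rw [sum_spatial _ (dr_zero x)]
    have : ∀ l, dr x l * (dr x i * dr x l) = dr x i * (dr x l * dr x l) := fun l => by ring
    simp_rw [this]
    rw [← Finset.mul_sum, sum_dr_mul_dr hx]
    ring
  sum_ss i j := by
    have h : ∀ l, angProj x i l * angProj x j l =
        angProj x i l * (if j = l ∧ j ≠ 0 then 1 else 0)
          - dr x j * (dr x l * (if i = l ∧ i ≠ 0 then 1 else 0))
          + dr x i * dr x j * (dr x l * dr x l) := fun l => by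
      simp only [angProj]; ring
    simp_rw [h]
    rw [Finset.sum_add_distrib, Finset.sum_sub_distrib, ← Finset.mul_sum, ← Finset.mul_sum,
      sum_dr_mul_dr hx, sum_spatial _ (dr_zero x), sum_spatial _ (by by_cases h : i = 0 <;> simp [h, angProj])]
    ring
  trace := by
    simp only [angProj, Finset.sum_sub_distrib, sum_dr_mul_dr hx]
    simp [Fin.sum_univ_succ]
  one i j := by
    unfold angProj dt
    by_cases h : i = j
    · by_cases h' : i = 0 <;> subst h <;> simp [h']
    · have : ¬ (i = 0 ∧ j = 0) := fun hh => h (hh.1.trans hh.2.symm)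
      by_cases h' : i = 0 <;> simp_all

namespace IsSplitting

variable {N : ℕ} {τ ν : Fin N → ℝ} {σ : Fin N → Fin N → ℝ} {m : ℝ}

/-- The workhorse for index sums: both factors are vectors in the summed index, spanned by τ, ν and
three rows of σ. Callers that need fewer rows set the spare coefficients to 0 and choose the spare
indices arbitrarily. -/
lemma contract (H : IsSplitting τ ν σ m) (a₁ a₂ a₃ a₄ a₅ b₁ b₂ b₃ b₄ b₅ : ℝ) (i j k i' j' k' : Fin N) :
    ∑ l, (τ l * a₁ + ν l * a₂ + σ i l * a₃ + σ j l * a₄ + σ k l * a₅) *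
      (τ l * b₁ + ν l * b₂ + σ i' l * b₃ + σ j' l * b₄ + σ k' l * b₅) =
    a₁ * b₁ + a₂ * b₂ + a₃ * (b₃ * σ i i' + b₄ * σ i j' + b₅ * σ i k')
      + a₄ * (b₃ * σ j i' + b₄ * σ j j' + b₅ * σ j k')
      + a₅ * (b₃ * σ k i' + b₄ * σ k j' + b₅ * σ k k') := by
  have h : ∀ l, (τ l * a₁ + ν l * a₂ + σ i l * a₃ + σ j l * a₄ + σ k l * a₅) *
      (τ l * b₁ + ν l * b₂ + σ i' l * b₃ + σ j' l * b₄ + σ k' l * b₅) =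
      (τ l * τ l) * (a₁ * b₁) + (ν l * ν l) * (a₂ * b₂) + (τ l * ν l) * (a₁ * b₂ + a₂ * b₁)
      + (τ l * σ i l) * (a₃ * b₁) + (τ l * σ j l) * (a₄ * b₁) + (τ l * σ k l) * (a₅ * b₁)
      + (ν l * σ i l) * (a₃ * b₂) + (ν l * σ j l) * (a₄ * b₂) + (ν l * σ k l) * (a₅ * b₂)
      + (τ l * σ i' l) * (a₁ * b₃) + (τ l * σ j' l) * (a₁ * b₄) + (τ l * σ k' l) * (a₁ * b₅)
      + (ν l * σ i' l) * (a₂ * b₃) + (ν l * σ j' l) * (a₂ * b₄) + (ν l * σ k' l) * (a₂ * b₅)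
      + (σ i l * σ i' l) * (a₃ * b₃) + (σ i l * σ j' l) * (a₃ * b₄) + (σ i l * σ k' l) * (a₃ * b₅)
      + (σ j l * σ i' l) * (a₄ * b₃) + (σ j l * σ j' l) * (a₄ * b₄) + (σ j l * σ k' l) * (a₄ * b₅)
      + (σ k l * σ i' l) * (a₅ * b₃) + (σ k l * σ j' l) * (a₅ * b₄)
      + (σ k l * σ k' l) * (a₅ * b₅) :=
    fun l => by ring
  simp_rw [h]
  simp only [Finset.sum_add_distrib, ← Finset.sum_mul, H.sum_tt, H.sum_nn, H.sum_tn, H.sum_ts,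
    H.sum_ns, H.sum_ss]
  ring

/-- Serves for both lowering and raising an index: take `u`, `v` to be W², f²/r² or their inverses.
-/
lemma raise (H : IsSplitting τ ν σ m) (u v : ℝ) (a₁ a₂ a₃ a₄ a₅ : ℝ) (i j k l : Fin N) :
    ∑ s, (-(τ l * τ s) + u * (ν l * ν s) + v * σ l s) *
      (τ s * a₁ + ν s * a₂ + σ i s * a₃ + σ j s * a₄ + σ k s * a₅) =
    -(τ l * a₁) + u * (ν l * a₂) + v * (σ l i * a₃ + σ l j * a₄ + σ l k * a₅) := by
  have := H.contract (-τ l) (u * ν l) v 0 0 a₁ a₂ a₃ a₄ a₅ l l l i j k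
  rw [show -(τ l * a₁) + u * (ν l * a₂) + v * (σ l i * a₃ + σ l j * a₄ + σ l k * a₅) = _ from
    Eq.trans (by ring) this.symm]
  exact Finset.sum_congr rfl fun s _ => by ring

lemma inv_eq (H : IsSplitting τ ν σ m) {u v : ℝ} (hu : u ≠ 0) (hv : v ≠ 0)
    {g : Matrix (Fin N) (Fin N) ℝ}
    (hg : ∀ i j, g i j = -(τ i * τ j) + u * (ν i * ν j) + v * σ i j) (i j : Fin N) :
    g⁻¹ i j = -(τ i * τ j) + u⁻¹ * (ν i * ν j) + v⁻¹ * σ i j := by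
  have : g * Matrix.of (fun i j => -(τ i * τ j) + u⁻¹ * (ν i * ν j) + v⁻¹ * σ i j) = 1 := by
    ext i j
    rw [Matrix.mul_apply, Matrix.one_apply, H.one]
    have := H.raise u v (-τ j) (u⁻¹ * ν j) v⁻¹ 0 0 j j j i
    rw [← (show _ = τ i * τ j + ν i * ν j + σ i j from
      this.trans (by field_simp; ring))]
    refine Finset.sum_congr rfl fun s _ => ?_
    rw [hg, Matrix.of_apply, H.symm s j]
    ring
  rw [Matrix.inv_eq_right_inv this]
  rfl

end IsSplitting

/-! ### Differential calculus for functions of t and r and for the splitting -/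

/-- `F` is differentiable at `x` with differential `u dt + v dr`. -/
def HasTR {n : ℕ} (x : Fin (n + 1) → ℝ) (F : (Fin (n + 1) → ℝ) → ℝ) (u v : ℝ) : Prop :=
  HasFDerivAt F (∑ i, (u * dt i + v * dr x i) •
    (ContinuousLinearMap.proj i : (Fin (n + 1) → ℝ) →L[ℝ] ℝ)) x

/-- `F` is differentiable at `x` with partial derivatives `v i`. -/
def HasPD {N : ℕ} (x : Fin N → ℝ) (F : (Fin N → ℝ) → ℝ) (v : Fin N → ℝ) : Prop :=
  HasFDerivAt F (∑ i, v i • (ContinuousLinearMap.proj i : (Fin N → ℝ) →L[ℝ] ℝ)) x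

namespace HasPD

variable {N : ℕ} {x : Fin N → ℝ} {F G : (Fin N → ℝ) → ℝ} {u v : Fin N → ℝ}

lemma congr (h : HasPD x F u) (huv : ∀ i, u i = v i) : HasPD x F v := by
  rwa [← funext huv]

lemma congr_fun (h : HasPD x F u) (hG : ∀ y, G y = F y) : HasPD x G u := by
  rwa [funext hG]

lemma of_hasFDerivAt {L : (Fin N → ℝ) →L[ℝ] ℝ} (h : HasFDerivAt F L x) :
    HasPD x F (fun i => L (Pi.single i 1)) := by
  refine h.congr_fderiv ?_
  ext y
  simp only [sum_apply, smul_apply, ContinuousLinearMap.proj_apply, smul_eq_mul]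
  have hy : y = ∑ i, y i • (Pi.single i 1 : Fin N → ℝ) := by
    ext j
    simp [Finset.sum_apply, Pi.single_apply]
  conv_lhs => rw [hy, map_sum]
  simp [mul_comm]

lemma const (c : ℝ) : HasPD x (fun _ => c) (fun _ => 0) :=
  (of_hasFDerivAt (hasFDerivAt_const c x)).congr (by simp)

lemma add (hF : HasPD x F u) (hG : HasPD x G v) :
    HasPD x (fun y => F y + G y) (fun i => u i + v i) := by
  refine (HasFDerivAt.add hF hG).congr_fderiv ?_
  simp [add_smul, Finset.sum_add_distrib]

lemma mul (hF : HasPD x F u) (hG : HasPD x G v) :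
    HasPD x (fun y => F y * G y) (fun i => u i * G x + F x * v i) := by
  refine (HasFDerivAt.mul hF hG).congr_fderiv ?_
  simp only [Finset.smul_sum, smul_smul, add_smul, Finset.sum_add_distrib]
  rw [add_comm]
  congr 1
  exact Finset.sum_congr rfl fun i _ => by rw [mul_comm]

lemma sub (hF : HasPD x F u) (hG : HasPD x G v) :
    HasPD x (fun y => F y - G y) (fun i => u i - v i) :=
  ((hF.add ((const (-1)).mul hG)).congr fun i => by ring).congr_fun fun y => by ring

lemma comp {φ : ℝ → ℝ} {φ' : ℝ} (hφ : HasDerivAt φ φ' (F x)) (hF : HasPD x F u) :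
    HasPD x (fun y => φ (F y)) (fun i => φ' * u i) := by
  refine (HasDerivAt.comp_hasFDerivAt x hφ hF).congr_fderiv ?_
  simp [Finset.smul_sum, smul_smul]

lemma pd_eq (hF : HasPD x F u) (i : Fin N) : pd i F x = u i := by
  unfold pd
  rw [hF.fderiv]
  simp [Pi.single_apply]

end HasPD

namespace HasTR

variable {n : ℕ} {x : Fin (n + 1) → ℝ} {F G : (Fin (n + 1) → ℝ) → ℝ} {u v u' v' : ℝ}

lemma hasPD (h : HasTR x F u v) : HasPD x F (fun i => u * dt i + v * dr x i) := h

lemma congr (h : HasTR x F u v) (hu : u = u') (hv : v = v') : HasTR x F u' v' := by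
  subst hu hv; exact h

lemma congr_fun (h : HasTR x F u v) (hG : ∀ y, G y = F y) : HasTR x G u v := by
  rwa [funext hG]

lemma congr_of_eventuallyEq (h : HasTR x F u v) (hG : G =ᶠ[𝓝 x] F) : HasTR x G u v :=
  HasFDerivAt.congr_of_eventuallyEq h hG

lemma const (c : ℝ) : HasTR x (fun _ => c) 0 0 :=
  (HasPD.const c).congr (by simp)

lemma add (hF : HasTR x F u v) (hG : HasTR x G u' v') :
    HasTR x (fun y => F y + G y) (u + u') (v + v') :=
  (HasPD.add hF hG).congr fun i => by ring

lemma sub (hF : HasTR x F u v) (hG : HasTR x G u' v') :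
    HasTR x (fun y => F y - G y) (u - u') (v - v') :=
  (HasPD.sub hF hG).congr fun i => by ring

lemma mul (hF : HasTR x F u v) (hG : HasTR x G u' v') :
    HasTR x (fun y => F y * G y) (u * G x + F x * u') (v * G x + F x * v') :=
  (HasPD.mul hF hG).congr fun i => by ring

lemma comp {φ : ℝ → ℝ} {φ' : ℝ} (hφ : HasDerivAt φ φ' (F x)) (hF : HasTR x F u v) :
    HasTR x (fun y => φ (F y)) (φ' * u) (φ' * v) :=
  (HasPD.comp hφ hF).congr fun i => by ring

lemma pow (hF : HasTR x F u v) (k : ℕ) :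
    HasTR x (fun y => F y ^ k) (k * F x ^ (k - 1) * u) (k * F x ^ (k - 1) * v) :=
  comp (hasDerivAt_pow k (F x)) hF

lemma inv (hF : HasTR x F u v) (h0 : F x ≠ 0) :
    HasTR x (fun y => (F y)⁻¹) (-u / F x ^ 2) (-v / F x ^ 2) :=
  (comp (hasDerivAt_inv h0) hF).congr (by ring) (by ring)

lemma div (hF : HasTR x F u v) (hG : HasTR x G u' v') (h0 : G x ≠ 0) :
    HasTR x (fun y => F y / G y) ((u * G x - F x * u') / G x ^ 2)
      ((v * G x - F x * v') / G x ^ 2) :=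
  ((mul hF (inv hG h0)).congr (by field_simp; ring) (by field_simp; ring)).congr_fun fun y => div_eq_mul_inv _ _

lemma time : HasTR x (fun y => y 0) 1 0 :=
  (HasPD.of_hasFDerivAt (hasFDerivAt_apply 0 x)).congr fun i => by
    simp [Pi.single_apply, dt, eq_comm]

lemma of_time {φ : ℝ → ℝ} {φ' : ℝ} (hφ : HasDerivAt φ φ' (x 0)) : HasTR x (fun y => φ (y 0)) φ' 0 :=
  (comp hφ time).congr (by ring) (by ring)

lemma rad (hx : rad x ≠ 0) : HasTR x rad 0 1 := by
  have hs : ∑ i : Fin n, x i.succ ^ 2 ≠ 0 := by rw [← rad_sq]; positivity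
  have h : HasFDerivAt (fun y : Fin (n + 1) → ℝ => ∑ i : Fin n, y i.succ ^ 2)
      (∑ i : Fin n, (2 * x i.succ) •
        (ContinuousLinearMap.proj i.succ : (Fin (n + 1) → ℝ) →L[ℝ] ℝ)) x := by
    refine HasFDerivAt.fun_sum fun i _ => ?_
    exact ((hasFDerivAt_apply i.succ x).pow 2).congr_fderiv (by ext; simp)
  refine (HasPD.comp (F := fun y : Fin (n + 1) → ℝ => ∑ i : Fin n, y i.succ ^ 2)
    (Real.hasDerivAt_sqrt hs) (HasPD.of_hasFDerivAt h)).congr fun i => ?_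
  change 1 / (2 * KTCosmology.rad x) * _ = _
  refine Fin.cases ?_ (fun j => ?_) i
  · simp [Fin.succ_ne_zero]
  · simp only [sum_apply, smul_apply,
      ContinuousLinearMap.proj_apply, dt_succ, dr_succ, smul_eq_mul, Pi.single_apply]
    simp
    field_simp

end HasTR

/-- The Hessian of r. It makes polynomials in τ, ν, σ closed under differentiation, up to factors
1/r. -/
lemma hasPD_dr {n : ℕ} {x : Fin (n + 1) → ℝ} (hx : rad x ≠ 0) (j : Fin (n + 1)) :
    HasPD x (fun y => dr y j) (fun i => angProj x i j / rad x) := by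
  by_cases hj : j = 0
  · subst hj
    simp only [dr_zero]
    refine (HasPD.const 0).congr fun i => ?_
    have : angProj x i 0 = 0 := by by_cases h : i = 0 <;> simp [angProj, h]
    simp [this]
  · have h := (HasPD.of_hasFDerivAt (hasFDerivAt_apply j x)).mul ((HasTR.rad hx).inv hx).hasPD
    refine (h.congr fun i => ?_).congr_fun fun y => by
      simp only [dr, hj, if_false]; exact div_eq_mul_inv _ _
    have hj' : x j = dr x j * rad x := by simp only [dr, hj, if_false]; field_simp
    simp only [ContinuousLinearMap.proj_apply, angProj, hj']
    by_cases hij : i = j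
    · subst hij; simp [hj]; field_simp; ring
    · simp [hij, Ne.symm hij]; field_simp

lemma hasPD_angProj {n : ℕ} {x : Fin (n + 1) → ℝ} (hx : rad x ≠ 0) (j k : Fin (n + 1)) :
    HasPD x (fun y => angProj y j k)
      (fun i => -(angProj x i j * dr x k + dr x j * angProj x i k) / rad x) :=
  ((HasPD.const _).sub ((hasPD_dr hx j).mul (hasPD_dr hx k))).congr fun i => by ring

end KTCosmology

/-! ### Christoffel symbols of a spherically symmetric metric -/

namespace KTCosmology

open Topology

/-- The metric coefficients `W`, `f` as functions on space-time have first partial derivatives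
in `t`, `r` at `x`, and the metric is nondegenerate there. -/
structure HasFirstJet {n : ℕ} (W f Wt Wr ft fr : (Fin (n + 1) → ℝ) → ℝ) (x : Fin (n + 1) → ℝ) :
    Prop where
  rad_pos : 0 < rad x
  W_ne : W x ≠ 0
  f_ne : f x ≠ 0
  W' : HasTR x W (Wt x) (Wr x)
  f' : HasTR x f (ft x) (fr x)

/-- Christoffel symbols built from the splitting `τ`, `ν`, `σ`. -/
def splitChristoffel {N : ℕ} (τ ν : Fin N → ℝ) (σ : Fin N → Fin N → ℝ) (α β p w c q d : ℝ)
    (l i j : Fin N) : ℝ :=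
  τ l * (α * (ν i * ν j) + β * σ i j)
    + ν l * (p * (τ i * ν j + ν i * τ j) + w * (ν i * ν j) + c * σ i j)
    + q * (τ i * σ l j + τ j * σ l i) + d * (ν i * σ l j + ν j * σ l i)

lemma sphericalMetric_inv {n : ℕ} {W f : ℝ → ℝ → ℝ} {x : Fin (n + 1) → ℝ} (hr : rad x ≠ 0)
    (hW : W (x 0) (rad x) ≠ 0) (hf : f (x 0) (rad x) ≠ 0) (i j : Fin (n + 1)) :
    (sphericalMetric n W f x)⁻¹ i j = -(dt i * dt j)
      + (W (x 0) (rad x) ^ 2)⁻¹ * (dr x i * dr x j)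
      + (f (x 0) (rad x) ^ 2 / rad x ^ 2)⁻¹ * angProj x i j :=
  (isSplitting hr).inv_eq (by positivity) (by positivity)
    (fun i j => by simp only [sphericalMetric, Matrix.of_apply, roundMetric, angProj]; ring) i j

lemma sphericalMetric_apply {n : ℕ} (W f : ℝ → ℝ → ℝ) (x : Fin (n + 1) → ℝ) (i j : Fin (n + 1)) :
    sphericalMetric n W f x i j = -(dt i * dt j)
      + W (x 0) (rad x) ^ 2 * (dr x i * dr x j)
      + f (x 0) (rad x) ^ 2 / rad x ^ 2 * angProj x i j := by
  simp only [sphericalMetric, Matrix.of_apply, roundMetric, angProj]; ring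

section

variable {n : ℕ} {W f : ℝ → ℝ → ℝ} {Wt Wr ft fr : (Fin (n + 1) → ℝ) → ℝ} {x : Fin (n + 1) → ℝ}

/-- The middle group arises because ν and σ turn from point to point: it carries the difference of
the radial and angular coefficients and would vanish for an isotropic spatial metric. -/
lemma hasPD_sphericalMetric
    (h : HasFirstJet (fun y => W (y 0) (rad y)) (fun y => f (y 0) (rad y)) Wt Wr ft fr x)
    (j k : Fin (n + 1)) :
    HasPD x (fun y => sphericalMetric n W f y j k) (fun i =>
      2 * W (x 0) (rad x) * (Wt x * dt i + Wr x * dr x i) * (dr x j * dr x k)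
      + (W (x 0) (rad x) ^ 2 - f (x 0) (rad x) ^ 2 / rad x ^ 2) / rad x *
        (angProj x i j * dr x k + dr x j * angProj x i k)
      + 2 * f (x 0) (rad x) / rad x ^ 2 *
        (ft x * dt i + (fr x - f (x 0) (rad x) / rad x) * dr x i) * angProj x j k) := by
  have hr := h.rad_pos.ne'
  refine ((((HasPD.const (-(dt j * dt k))).add ((h.W'.pow 2).hasPD.mul
    ((hasPD_dr hr j).mul (hasPD_dr hr k)))).add (((h.f'.pow 2).div ((HasTR.rad hr).pow 2)
    (by positivity)).hasPD.mul (hasPD_angProj hr j k))).congr fun i => ?_).congr_fun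
    fun y => sphericalMetric_apply W f y j k
  field_simp
  push_cast
  ring

lemma christoffel_sphericalMetric
    (h : HasFirstJet (fun y => W (y 0) (rad y)) (fun y => f (y 0) (rad y)) Wt Wr ft fr x)
    (l i j : Fin (n + 1)) :
    christoffel (sphericalMetric n W f) l i j x =
      splitChristoffel dt (dr x) (angProj x)
        (W (x 0) (rad x) * Wt x) (f (x 0) (rad x) * ft x / rad x ^ 2)
        (Wt x / W (x 0) (rad x)) (Wr x / W (x 0) (rad x))
        (1 / rad x - f (x 0) (rad x) * fr x / (W (x 0) (rad x) ^ 2 * rad x ^ 2))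
        (ft x / f (x 0) (rad x)) (fr x / f (x 0) (rad x) - 1 / rad x) l i j := by
  have hr := h.rad_pos.ne'
  have hW := h.W_ne
  have hf := h.f_ne
  have H := isSplitting hr
  change W (x 0) (rad x) ≠ 0 at hW
  change f (x 0) (rad x) ≠ 0 at hf
  unfold christoffel
  simp only [(hasPD_sphericalMetric h _ _).pd_eq, sphericalMetric_inv hr hW hf]
  set V := W (x 0) (rad x)
  set F := f (x 0) (rad x)
  -- The bracket `∂_i g_js + ∂_j g_is - ∂_s g_ij`, sorted as a vector in `s` along τ, ν and the rows
  -- `i`, `j` of σ; the third row is not needed.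
  have e := H.raise (V ^ 2)⁻¹ (F ^ 2 / rad x ^ 2)⁻¹
    (-2 * V * Wt x * (dr x i * dr x j) - 2 * F / rad x ^ 2 * ft x * angProj x i j)
    (2 * V * (Wt x * dt i + Wr x * dr x i) * dr x j + 2 * V * (Wt x * dt j + Wr x * dr x j) * dr x i
      - 2 * V * Wr x * (dr x i * dr x j)
      + (V ^ 2 - F ^ 2 / rad x ^ 2) / rad x * (2 * angProj x i j)
      - 2 * F / rad x ^ 2 * (fr x - F / rad x) * angProj x i j)
    (2 * F / rad x ^ 2 * (ft x * dt j + (fr x - F / rad x) * dr x j))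
    (2 * F / rad x ^ 2 * (ft x * dt i + (fr x - F / rad x) * dr x i))
    0 i j j l
  rw [Finset.sum_congr rfl (fun s _ => ?_), e]
  · unfold splitChristoffel
    field_simp
    ring
  · rw [H.symm s i, H.symm s j, H.symm j i]
    ring

end

end KTCosmology

/-! ### The Riemann tensor from split Christoffel symbols -/

namespace KTCosmology

open Topology

/-- The form of the curvature tensor `R^l_{kij}` of `splitChristoffel`. -/
def splitRiemann {N : ℕ} (τ ν : Fin N → ℝ) (σ : Fin N → Fin N → ℝ)
    (A B C₁ C₂ D₁ D₂ E₁ E₂ E₃ E₄ F Z₁ Z₂ : ℝ) (l k i j : Fin N) : ℝ :=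
  (A * (τ l * ν k) + B * (ν l * τ k) + Z₁ * (ν l * ν k) + Z₂ * σ l k) * (τ i * ν j - ν i * τ j)
    + (C₁ * τ l + D₁ * ν l) * (τ i * σ k j - τ j * σ k i)
    + (C₂ * τ l + D₂ * ν l) * (ν i * σ k j - ν j * σ k i)
    + (E₁ * τ k + E₃ * ν k) * (τ j * σ l i - τ i * σ l j)
    + (E₂ * τ k + E₄ * ν k) * (ν j * σ l i - ν i * σ l j)
    + F * (σ l i * σ k j - σ l j * σ k i)

lemma hasPD_splitChristoffel {n : ℕ} {x : Fin (n + 1) → ℝ} (hr : rad x ≠ 0)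
    {α β p w c q d : (Fin (n + 1) → ℝ) → ℝ} {αt αr βt βr pt pr wt wr ct cr qt qr δt δr : ℝ}
    (hα : HasTR x α αt αr) (hβ : HasTR x β βt βr) (hp : HasTR x p pt pr) (hw : HasTR x w wt wr)
    (hc : HasTR x c ct cr) (hq : HasTR x q qt qr) (hd : HasTR x d δt δr) (l j k : Fin (n + 1)) :
    HasPD x (fun y => splitChristoffel dt (dr y) (angProj y) (α y) (β y) (p y) (w y) (c y) (q y)
      (d y) l j k) (fun i =>
      dt l * ((αt * dt i + αr * dr x i) * (dr x j * dr x k) + (βt * dt i + βr * dr x i) * angProj x j k)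
      + dr x l * ((pt * dt i + pr * dr x i) * (dt j * dr x k + dr x j * dt k)
        + (wt * dt i + wr * dr x i) * (dr x j * dr x k) + (ct * dt i + cr * dr x i) * angProj x j k)
      + (qt * dt i + qr * dr x i) * (dt j * angProj x l k + dt k * angProj x l j)
      + (δt * dt i + δr * dr x i) * (dr x j * angProj x l k + dr x k * angProj x l j)
      + (dt l * ((α x - β x) * (angProj x i j * dr x k + dr x j * angProj x i k))
        + angProj x i l * (p x * (dt j * dr x k + dr x j * dt k) + w x * (dr x j * dr x k)
          + c x * angProj x j k)
        + dr x l * (p x * (dt j * angProj x i k + angProj x i j * dt k)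
          + (w x - c x) * (angProj x i j * dr x k + dr x j * angProj x i k))
        - q x * (dt j * (angProj x i l * dr x k + dr x l * angProj x i k)
          + dt k * (angProj x i l * dr x j + dr x l * angProj x i j))
        + d x * (angProj x i j * angProj x l k + angProj x i k * angProj x l j
          - dr x j * (angProj x i l * dr x k + dr x l * angProj x i k)
          - dr x k * (angProj x i l * dr x j + dr x l * angProj x i j))) / rad x) := by
  have N := hasPD_dr hr
  have S := hasPD_angProj hr
  have T : ∀ i : Fin (n + 1), HasPD x (fun _ => dt i) (fun _ => 0) := fun i => HasPD.const _
  unfold splitChristoffel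
  refine ((((T l).mul ((hα.hasPD.mul ((N j).mul (N k))).add (hβ.hasPD.mul (S j k)))).add
    ((N l).mul (((hp.hasPD.mul (((T j).mul (N k)).add ((N j).mul (T k)))).add
      (hw.hasPD.mul ((N j).mul (N k)))).add (hc.hasPD.mul (S j k))))).add
    (hq.hasPD.mul (((T j).mul (S l k)).add ((T k).mul (S l j))))).add
    (hd.hasPD.mul (((N j).mul (S l k)).add ((N k).mul (S l j)))) |>.congr fun i => ?_
  ring

/-- The coefficients are kept as unrelated functions, which keeps the computation polynomial. The
last two entries, `wt - pr` and `δt - qr`, vanish once the coefficients come from a metric. -/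
lemma riemannUp_of_splitChristoffel {n : ℕ} {x : Fin (n + 1) → ℝ} (hr : rad x ≠ 0)
    {g : (Fin (n + 1) → ℝ) → Matrix (Fin (n + 1)) (Fin (n + 1)) ℝ}
    {α β p w c q d : (Fin (n + 1) → ℝ) → ℝ} {αt αr βt βr pt pr wt wr ct cr qt qr δt δr : ℝ}
    (hα : HasTR x α αt αr) (hβ : HasTR x β βt βr) (hp : HasTR x p pt pr) (hw : HasTR x w wt wr)
    (hc : HasTR x c ct cr) (hq : HasTR x q qt qr) (hd : HasTR x d δt δr)
    (hg : ∀ᶠ y in 𝓝 x, ∀ l i j, christoffel g l i j y =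
      splitChristoffel dt (dr y) (angProj y) (α y) (β y) (p y) (w y) (c y) (q y) (d y) l i j)
    (l k i j : Fin (n + 1)) :
    riemannUp g l k i j x = splitRiemann dt (dr x) (angProj x)
      (αt - α x * p x) (pt + p x ^ 2) (βt - β x * q x)
      (βr + (β x - α x) / rad x + α x * c x - β x * d x)
      (ct + (q x - p x) / rad x + p x * c x - c x * q x)
      (cr + (c x - w x + d x) / rad x + p x * β x + w x * c x - c x * d x)
      (-qt - q x ^ 2) (-qr + (p x - q x) / rad x + d x * p x - q x * d x)
      (-δt + (p x - q x) / rad x + d x * p x - q x * d x)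
      (-δr + (w x - 2 * d x) / rad x + q x * α x + d x * w x - d x ^ 2)
      (q x * β x + d x * c x + (c x - d x) / rad x) (wt - pr) (δt - qr) l k i j := by
  have hpd : ∀ l j k, HasPD x (christoffel g l j k) _ := fun l j k =>
    HasFDerivAt.congr_of_eventuallyEq (hasPD_splitChristoffel hr hα hβ hp hw hc hq hd l j k)
      (hg.mono fun y hy => hy l j k)
  unfold riemannUp
  simp only [(hpd _ _ _).pd_eq, hg.self_of_nhds]
  have H := isSplitting hr
  set τ : Fin (n + 1) → ℝ := dt
  set ν := dr x
  set σ := angProj x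
  -- Each product ΓΓ is a pairing of two vectors in `m`, so a single use of `contract` evaluates it.
  have e : ∀ l i j k, ∑ m, splitChristoffel τ ν σ (α x) (β x) (p x) (w x) (c x) (q x) (d x) l i m *
      splitChristoffel τ ν σ (α x) (β x) (p x) (w x) (c x) (q x) (d x) m j k = _ := fun l i j k =>
    Eq.trans (Finset.sum_congr rfl fun m _ => by
      unfold splitChristoffel
      rw [H.symm m j, H.symm m k]
      ring) (H.contract (p x * (ν l * ν i) + q x * σ l i)
      (α x * (τ l * ν i) + p x * (ν l * τ i) + w x * (ν l * ν i) + d x * σ l i)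
      (β x * τ l + c x * ν l) (q x * τ i + d x * ν i) 0
      (α x * (ν j * ν k) + β x * σ j k)
      (p x * (τ j * ν k + ν j * τ k) + w x * (ν j * ν k) + c x * σ j k)
      (q x * τ j + d x * ν j) (q x * τ k + d x * ν k) 0 i l l k j j)
  rw [Finset.sum_sub_distrib, e, e]
  unfold splitRiemann
  rw [H.symm i l, H.symm j l, H.symm j k, H.symm j i, H.symm i k]
  field_simp
  ring

end KTCosmology

/-! ### Contractions of curvature-type tensors -/

namespace KTCosmology

open Topology

namespace IsSplitting

variable {N : ℕ} {τ ν : Fin N → ℝ} {σ : Fin N → Fin N → ℝ} {m : ℝ}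

lemma sum_splitRiemann_trace (H : IsSplitting τ ν σ m) (A B C₁ C₂ D₁ D₂ E₁ E₂ E₃ E₄ F : ℝ)
    (k j : Fin N) :
    ∑ l, splitRiemann τ ν σ A B C₁ C₂ D₁ D₂ E₁ E₂ E₃ E₄ F 0 0 l k l j =
      (m * E₁ - B) * (τ k * τ j) + m * E₂ * (τ k * ν j) + m * E₃ * (ν k * τ j)
        + (A + m * E₄) * (ν k * ν j) + (C₁ + D₂ + (m - 1) * F) * σ k j := by
  have h : ∀ l, splitRiemann τ ν σ A B C₁ C₂ D₁ D₂ E₁ E₂ E₃ E₄ F 0 0 l k l j =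
      (τ l * τ l) * (A * ν k * ν j + C₁ * σ k j) + (ν l * ν l) * (-B * τ k * τ j + D₂ * σ k j)
      + (τ l * ν l) * (B * τ k * ν j - A * ν k * τ j + D₁ * σ k j + C₂ * σ k j)
      - (τ l * σ k l) * (C₁ * τ j + C₂ * ν j)
      - (ν l * σ k l) * (D₁ * τ j + D₂ * ν j)
      + σ l l * (E₁ * τ k * τ j + E₂ * τ k * ν j + E₃ * ν k * τ j + E₄ * ν k * ν j + F * σ k j)
      - (τ l * σ j l) * (E₁ * τ k + E₃ * ν k) - (ν l * σ j l) * (E₂ * τ k + E₄ * ν k)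
      - (σ k l * σ j l) * F := fun l => by
    unfold splitRiemann
    rw [H.symm l j]
    ring
  simp_rw [h]
  simp only [Finset.sum_add_distrib, Finset.sum_sub_distrib, ← Finset.sum_mul, H.sum_tt, H.sum_nn,
    H.sum_tn, H.sum_ts, H.sum_ns, H.sum_ss, H.trace]
  ring

lemma sum_inv_mul (H : IsSplitting τ ν σ m) (u v a b c d e : ℝ) :
    ∑ k, ∑ j, (-(τ k * τ j) + u * (ν k * ν j) + v * σ k j) *
      (a * (τ k * τ j) + b * (τ k * ν j) + c * (ν k * τ j) + d * (ν k * ν j) + e * σ k j) =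
      -a + u * d + m * v * e := by
  have h : ∀ k, ∑ j, (-(τ k * τ j) + u * (ν k * ν j) + v * σ k j) *
      (a * (τ k * τ j) + b * (τ k * ν j) + c * (ν k * τ j) + d * (ν k * ν j) + e * σ k j) =
      (τ k * τ k) * (-a) + (τ k * ν k) * (u * b - c) + (ν k * ν k) * (u * d) + σ k k * (v * e) :=
    fun k => by
      have := H.contract (-τ k) (u * ν k) v 0 0 (a * τ k + c * ν k) (b * τ k + d * ν k) e 0 0
        k k k k k k
      rw [show (τ k * τ k) * (-a) + (τ k * ν k) * (u * b - c) + (ν k * ν k) * (u * d)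
        + σ k k * (v * e) = _ from Eq.trans (by ring) this.symm]
      exact Finset.sum_congr rfl fun s _ => by ring
  simp_rw [h]
  simp only [Finset.sum_add_distrib, ← Finset.sum_mul, H.sum_tt, H.sum_nn, H.sum_tn, H.trace]
  ring

lemma lower_splitRiemann (H : IsSplitting τ ν σ m) (u v A B C₁ C₂ D₁ D₂ E₁ E₂ E₃ E₄ F : ℝ)
    (l k i j : Fin N) :
    ∑ s, (-(τ l * τ s) + u * (ν l * ν s) + v * σ l s) *
      splitRiemann τ ν σ A B C₁ C₂ D₁ D₂ E₁ E₂ E₃ E₄ F 0 0 s k i j =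
      splitRiemann τ ν σ (-A) (u * B) (-C₁) (-C₂) (u * D₁) (u * D₂) (v * E₁) (v * E₂) (v * E₃)
        (v * E₄) (v * F) 0 0 l k i j := by
  have := H.raise u v (A * ν k * (τ i * ν j - ν i * τ j) + C₁ * (τ i * σ k j - τ j * σ k i)
      + C₂ * (ν i * σ k j - ν j * σ k i))
    (B * τ k * (τ i * ν j - ν i * τ j) + D₁ * (τ i * σ k j - τ j * σ k i)
      + D₂ * (ν i * σ k j - ν j * σ k i))
    ((E₁ * τ k + E₃ * ν k) * τ j + (E₂ * τ k + E₄ * ν k) * ν j + F * σ k j)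
    (-((E₁ * τ k + E₃ * ν k) * τ i + (E₂ * τ k + E₄ * ν k) * ν i + F * σ k i)) 0 i j j l
  refine (Finset.sum_congr rfl fun s _ => ?_).trans (this.trans ?_)
  · unfold splitRiemann
    rw [H.symm s i, H.symm s j]
    ring
  · unfold splitRiemann
    ring

end IsSplitting

/-- The general tensor that has the algebraic symmetries of a curvature tensor and is built from
`τ`, `ν`, `σ` without terms mixing `τ` and `ν` (the form of a spherically symmetric Weyl tensor). -/
def splitWeyl {N : ℕ} (τ ν : Fin N → ℝ) (σ : Fin N → Fin N → ℝ) (x₁ x₂ x₃ x₄ : ℝ)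
    (a b c d : Fin N) : ℝ :=
  x₁ * ((τ a * ν b - ν a * τ b) * (τ c * ν d - ν c * τ d))
    + x₂ * (τ a * τ c * σ b d + τ b * τ d * σ a c - τ a * τ d * σ b c - τ b * τ c * σ a d)
    + x₃ * (ν a * ν c * σ b d + ν b * ν d * σ a c - ν a * ν d * σ b c - ν b * ν c * σ a d)
    + x₄ * (σ a c * σ b d - σ a d * σ b c)

namespace IsSplitting

variable {N : ℕ} {τ ν : Fin N → ℝ} {σ : Fin N → Fin N → ℝ} {m : ℝ}

/-- Each τ index contributes -1, each ν index `u`, each σ index `v`. Every term has an even number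
of each kind, so the signs cancel. The sums are done one index at a time from the innermost
outwards. -/
lemma raise_splitWeyl (H : IsSplitting τ ν σ m) (u v x₁ x₂ x₃ x₄ : ℝ) (a b c d : Fin N) :
    ∑ a', (-(τ a * τ a') + u * (ν a * ν a') + v * σ a a') *
      ∑ b', (-(τ b * τ b') + u * (ν b * ν b') + v * σ b b') *
        ∑ c', (-(τ c * τ c') + u * (ν c * ν c') + v * σ c c') *
          ∑ d', (-(τ d * τ d') + u * (ν d * ν d') + v * σ d d') *
            splitWeyl τ ν σ x₁ x₂ x₃ x₄ a' b' c' d' =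
      splitWeyl τ ν σ (u ^ 2 * x₁) (v ^ 2 * x₂) (u ^ 2 * v ^ 2 * x₃) (v ^ 4 * x₄) a b c d := by
  have hd : ∀ a b c, ∑ d', (-(τ d * τ d') + u * (ν d * ν d') + v * σ d d') *
      splitWeyl τ ν σ x₁ x₂ x₃ x₄ a b c d' = _ := fun a b c =>
    (Finset.sum_congr rfl fun d' _ => by unfold splitWeyl; ring).trans
      (H.raise u v (-x₁ * (τ a * ν b - ν a * τ b) * ν c + x₂ * (τ b * σ a c - τ a * σ b c))
      (x₁ * (τ a * ν b - ν a * τ b) * τ c + x₃ * (ν b * σ a c - ν a * σ b c))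
      (-x₂ * τ b * τ c - x₃ * ν b * ν c - x₄ * σ b c)
      (x₂ * τ a * τ c + x₃ * ν a * ν c + x₄ * σ a c) 0 a b b d)
  have hc : ∀ a b, ∑ c', (-(τ c * τ c') + u * (ν c * ν c') + v * σ c c') *
      ∑ d', (-(τ d * τ d') + u * (ν d * ν d') + v * σ d d') *
        splitWeyl τ ν σ x₁ x₂ x₃ x₄ a b c' d' = _ := fun a b =>
    (Finset.sum_congr rfl fun c' _ => by rw [hd a b c']; ring).trans
      (H.raise u v (x₁ * (τ a * ν b - ν a * τ b) * (u * ν d)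
        + x₂ * (τ a * (v * σ d b) - τ b * (v * σ d a)))
      (x₁ * (τ a * ν b - ν a * τ b) * τ d + x₃ * (ν a * (v * σ d b) - ν b * (v * σ d a)))
      (-x₂ * τ b * τ d + x₃ * ν b * (u * ν d) + x₄ * (v * σ d b))
      (x₂ * τ a * τ d - x₃ * ν a * (u * ν d) - x₄ * (v * σ d a)) 0 a b b c)
  have hb : ∀ a, ∑ b', (-(τ b * τ b') + u * (ν b * ν b') + v * σ b b') *
      ∑ c', (-(τ c * τ c') + u * (ν c * ν c') + v * σ c c') *
      ∑ d', (-(τ d * τ d') + u * (ν d * ν d') + v * σ d d') *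
        splitWeyl τ ν σ x₁ x₂ x₃ x₄ a b' c' d' = _ := fun a =>
    (Finset.sum_congr rfl fun b' _ => by rw [hc a b', H.symm d b', H.symm c b']; ring).trans
      (H.raise u v (-x₁ * ν a * (-u * τ c * ν d + u * ν c * τ d)
          + x₂ * (-τ d * (v * σ c a) + τ c * (v * σ d a)))
      (x₁ * τ a * (-u * τ c * ν d + u * ν c * τ d)
          + x₃ * (u * ν d * (v * σ c a) - u * ν c * (v * σ d a)))
      (-x₂ * τ a * τ c * v + x₃ * ν a * ν c * (u * v) + x₄ * σ c a * v ^ 2)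
      (x₂ * τ a * τ d * v - x₃ * ν a * ν d * (u * v) - x₄ * σ d a * v ^ 2) 0 d c c b)
  refine (Finset.sum_congr rfl fun a' _ => ?_).trans
      ((H.raise u v (x₁ * (u * ν b) * (-u * τ c * ν d + u * ν c * τ d)
          + x₂ * v ^ 2 * (-τ c * σ b d + τ d * σ b c))
      (x₁ * τ b * (-u * τ c * ν d + u * ν c * τ d)
          + x₃ * (u * v ^ 2) * (ν c * σ b d - ν d * σ b c))
      (x₂ * τ b * τ d * v + x₃ * u ^ 2 * v * ν b * ν d + x₄ * v ^ 3 * σ b d)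
      (-x₂ * τ b * τ c * v - x₃ * u ^ 2 * v * ν b * ν c - x₄ * v ^ 3 * σ b c) 0 c d d a).trans ?_)
  · rw [hb a', H.symm c a', H.symm d a']
    ring
  · unfold splitWeyl
    ring

end IsSplitting

end KTCosmology

namespace KTCosmology

open Topology

namespace IsSplitting

variable {N : ℕ} {τ ν : Fin N → ℝ} {σ : Fin N → Fin N → ℝ} {m : ℝ}

/-- The four building blocks are mutually orthogonal, so only their squared norms appear; these are
counted with `m`, the trace of σ. -/
lemma sum_splitWeyl_mul (H : IsSplitting τ ν σ m) (x₁ x₂ x₃ x₄ y₁ y₂ y₃ y₄ : ℝ) :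
    ∑ a, ∑ b, ∑ c, ∑ d, splitWeyl τ ν σ x₁ x₂ x₃ x₄ a b c d *
      splitWeyl τ ν σ y₁ y₂ y₃ y₄ a b c d =
      4 * (x₁ * y₁) + 4 * m * (x₂ * y₂) + 4 * m * (x₃ * y₃) + 2 * (m ^ 2 - m) * (x₄ * y₄) := by
  have hd : ∀ a b c, ∑ d, splitWeyl τ ν σ x₁ x₂ x₃ x₄ a b c d *
      splitWeyl τ ν σ y₁ y₂ y₃ y₄ a b c d = _ := fun a b c =>
    (Finset.sum_congr rfl fun d _ => by unfold splitWeyl; ring).trans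
      (H.contract (-x₁ * (τ a * ν b - ν a * τ b) * ν c + x₂ * (τ b * σ a c - τ a * σ b c))
      (x₁ * (τ a * ν b - ν a * τ b) * τ c + x₃ * (ν b * σ a c - ν a * σ b c))
      (-x₂ * τ b * τ c - x₃ * ν b * ν c - x₄ * σ b c)
      (x₂ * τ a * τ c + x₃ * ν a * ν c + x₄ * σ a c) 0
      (-y₁ * (τ a * ν b - ν a * τ b) * ν c + y₂ * (τ b * σ a c - τ a * σ b c))
      (y₁ * (τ a * ν b - ν a * τ b) * τ c + y₃ * (ν b * σ a c - ν a * σ b c))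
      (-y₂ * τ b * τ c - y₃ * ν b * ν c - y₄ * σ b c)
      (y₂ * τ a * τ c + y₃ * ν a * ν c + y₄ * σ a c) 0 a b b a b b)
  have hc : ∀ a b, ∑ c, ∑ d, splitWeyl τ ν σ x₁ x₂ x₃ x₄ a b c d *
      splitWeyl τ ν σ y₁ y₂ y₃ y₄ a b c d =
      2 * (x₁ * y₁) * (τ a * ν b - ν a * τ b) ^ 2
      + 2 * (x₂ * y₂) * (τ b ^ 2 * σ a a - 2 * τ a * τ b * σ a b + τ a ^ 2 * σ b b)
      + 2 * (x₃ * y₃) * (ν b ^ 2 * σ a a - 2 * ν a * ν b * σ a b + ν a ^ 2 * σ b b)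
      + 2 * (x₄ * y₄) * (σ a a * σ b b - σ a b ^ 2) := fun a b => by
    -- After the sum over `d`, the summand is a combination of products of two such vectors in `c`,
    -- which `contract` handles again.
    let L : ℝ → ℝ → ℝ → ℝ → Fin N → ℝ := fun p q r s c =>
      τ c * p + ν c * q + σ a c * r + σ b c * s + σ b c * 0
    have hL : ∀ p q r s p' q' r' s', ∑ c, L p q r s c * L p' q' r' s' c =
        p * p' + q * q' + r * (r' * σ a a + s' * σ a b) + s * (r' * σ a b + s' * σ b b) :=
      fun p q r s p' q' r' s' => (H.contract p q r s 0 p' q' r' s' 0 a b b a b b).trans (by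
        rw [H.symm b a]; ring)
    have key : ∀ c, ∑ d, splitWeyl τ ν σ x₁ x₂ x₃ x₄ a b c d *
        splitWeyl τ ν σ y₁ y₂ y₃ y₄ a b c d =
        L 0 (-x₁ * (τ a * ν b - ν a * τ b)) (x₂ * τ b) (-x₂ * τ a) c *
          L 0 (-y₁ * (τ a * ν b - ν a * τ b)) (y₂ * τ b) (-y₂ * τ a) c
        + L (x₁ * (τ a * ν b - ν a * τ b)) 0 (x₃ * ν b) (-x₃ * ν a) c *
          L (y₁ * (τ a * ν b - ν a * τ b)) 0 (y₃ * ν b) (-y₃ * ν a) c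
        + L (-x₂ * τ b) (-x₃ * ν b) 0 (-x₄) c * L (-y₂ * τ b) (-y₃ * ν b) 0 (-y₄) c * σ a a
        + L (-x₂ * τ b) (-x₃ * ν b) 0 (-x₄) c * L (y₂ * τ a) (y₃ * ν a) y₄ 0 c * σ a b
        + L (x₂ * τ a) (x₃ * ν a) x₄ 0 c * L (-y₂ * τ b) (-y₃ * ν b) 0 (-y₄) c * σ a b
        + L (x₂ * τ a) (x₃ * ν a) x₄ 0 c * L (y₂ * τ a) (y₃ * ν a) y₄ 0 c * σ b b := fun c => by
      rw [hd, H.symm b a]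
      simp only [L]
      ring
    simp_rw [key]
    simp only [Finset.sum_add_distrib, ← Finset.sum_mul, hL]
    ring
  simp_rw [hc]
  have hb : ∀ a, ∑ b, (2 * (x₁ * y₁) * (τ a * ν b - ν a * τ b) ^ 2
      + 2 * (x₂ * y₂) * (τ b ^ 2 * σ a a - 2 * τ a * τ b * σ a b + τ a ^ 2 * σ b b)
      + 2 * (x₃ * y₃) * (ν b ^ 2 * σ a a - 2 * ν a * ν b * σ a b + ν a ^ 2 * σ b b)
      + 2 * (x₄ * y₄) * (σ a a * σ b b - σ a b ^ 2)) =
      (τ a * τ a) * (2 * (x₁ * y₁) + 2 * (x₂ * y₂) * m)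
      + (ν a * ν a) * (2 * (x₁ * y₁) + 2 * (x₃ * y₃) * m)
      + σ a a * (2 * (x₂ * y₂) + 2 * (x₃ * y₃) + 2 * (x₄ * y₄) * (m - 1)) := fun a => by
    have h : ∀ b, 2 * (x₁ * y₁) * (τ a * ν b - ν a * τ b) ^ 2
      + 2 * (x₂ * y₂) * (τ b ^ 2 * σ a a - 2 * τ a * τ b * σ a b + τ a ^ 2 * σ b b)
      + 2 * (x₃ * y₃) * (ν b ^ 2 * σ a a - 2 * ν a * ν b * σ a b + ν a ^ 2 * σ b b)
      + 2 * (x₄ * y₄) * (σ a a * σ b b - σ a b ^ 2) =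
      (τ b * τ b) * (2 * (x₁ * y₁) * ν a ^ 2 + 2 * (x₂ * y₂) * σ a a)
      + (ν b * ν b) * (2 * (x₁ * y₁) * τ a ^ 2 + 2 * (x₃ * y₃) * σ a a)
      - (τ b * ν b) * (4 * (x₁ * y₁) * τ a * ν a)
      - (τ b * σ a b) * (4 * (x₂ * y₂) * τ a) - (ν b * σ a b) * (4 * (x₃ * y₃) * ν a)
      - (σ a b * σ a b) * (2 * (x₄ * y₄))
      + σ b b * (2 * (x₂ * y₂) * τ a ^ 2 + 2 * (x₃ * y₃) * ν a ^ 2 + 2 * (x₄ * y₄) * σ a a) :=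
      fun b => by ring
    simp_rw [h]
    simp only [Finset.sum_add_distrib, Finset.sum_sub_distrib, ← Finset.sum_mul, H.sum_tt,
      H.sum_nn, H.sum_tn, H.sum_ts, H.sum_ns, H.sum_ss, H.trace]
    ring
  simp_rw [hb]
  simp only [Finset.sum_add_distrib, ← Finset.sum_mul, H.sum_tt, H.sum_nn, H.trace]
  ring

end IsSplitting

/-- The metric coefficients `W`, `f` as functions on space-time have second partial derivatives in
`t`, `r` at `x`, and the metric is nondegenerate near `x`. -/
structure HasSecondJet {n : ℕ} (W f Wt Wr ft fr : (Fin (n + 1) → ℝ) → ℝ)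
    (Wtt Wtr Wrr ftt ftr frr : ℝ) (x : Fin (n + 1) → ℝ) : Prop where
  firstJet : ∀ᶠ y in 𝓝 x, HasFirstJet W f Wt Wr ft fr y
  Wt' : HasTR x Wt Wtt Wtr
  Wr' : HasTR x Wr Wtr Wrr
  ft' : HasTR x ft ftt ftr
  fr' : HasTR x fr ftr frr

section

variable {n : ℕ} {W f : ℝ → ℝ → ℝ} {Wt Wr ft fr : (Fin (n + 1) → ℝ) → ℝ}
  {Wtt Wtr Wrr ftt ftr frr : ℝ} {x : Fin (n + 1) → ℝ}

/-- Here `K` is the Gauss curvature of the two-metric `-dt² + W² dr²`, while `P`, `H`, `G` are the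
tt, tr, rr components of the Hessian of f for it, divided by f, and `Φ` is (1 - |∇f|²)/f². The two
final zeros are the equality of mixed partials, encoded in `HasSecondJet` by the shared `Wtr` and
`ftr`. -/
lemma riemannUp_sphericalMetric
    (h : HasSecondJet (fun y => W (y 0) (rad y)) (fun y => f (y 0) (rad y)) Wt Wr ft fr
      Wtt Wtr Wrr ftt ftr frr x) {w v φ K P H G Φ : ℝ}
    (hw : w = W (x 0) (rad x)) (hv : v = f (x 0) (rad x)) (hφ : φ = v ^ 2 / rad x ^ 2)
    (hK : K = Wtt / w) (hP : P = ftt / v) (hH : H = (ftr - Wt x * fr x / w) / v)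
    (hG : G = (frr - Wr x * fr x / w - w * Wt x * ft x) / v)
    (hΦ : Φ = (1 + ft x ^ 2 - fr x ^ 2 / w ^ 2) / v ^ 2)
    (l k i j : Fin (n + 1)) :
    riemannUp (sphericalMetric n W f) l k i j x = splitRiemann dt (dr x) (angProj x)
      (w ^ 2 * K) K (φ * P) (φ * H) (-φ * H / w ^ 2) (-φ * G / w ^ 2) (-P) (-H) (-H) (-G) (φ * Φ)
      0 0 l k i j := by
  have h1 := h.firstJet.self_of_nhds
  have hr := h1.rad_pos.ne'
  have hW := h1.W_ne
  have hf := h1.f_ne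
  have R := HasTR.rad hr
  have W' := h1.W'
  have f' := h1.f'
  have hr2 : rad x ^ 2 ≠ 0 := by positivity
  have hD : W (x 0) (rad x) ^ 2 * rad x ^ 2 ≠ 0 := mul_ne_zero (pow_ne_zero _ hW) hr2
  rw [riemannUp_of_splitChristoffel hr (W'.mul h.Wt') ((f'.mul h.ft').div (R.pow 2) hr2)
    (h.Wt'.div W' hW) (h.Wr'.div W' hW)
    (((HasTR.const 1).div R hr).sub ((f'.mul h.fr').div ((W'.pow 2).mul (R.pow 2)) hD))
    (h.ft'.div f' hf) ((h.fr'.div f' hf).sub ((HasTR.const 1).div R hr))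
    (h.firstJet.mono fun y hy l i j => christoffel_sphericalMetric hy l i j)]
  simp only [← hw, ← hv] at *
  subst hφ hK hP hH hG hΦ
  congr 1 <;> (field_simp; try (push_cast; ring))

end

end KTCosmology

/-! ### Ricci scalar and Weyl scalar for general W and f -/

namespace KTCosmology

open Topology

section

variable {n : ℕ} {W f : ℝ → ℝ → ℝ} {Wt Wr ft fr : (Fin (n + 1) → ℝ) → ℝ}
  {Wtt Wtr Wrr ftt ftr frr : ℝ} {x : Fin (n + 1) → ℝ}

lemma ricci_sphericalMetric
    (h : HasSecondJet (fun y => W (y 0) (rad y)) (fun y => f (y 0) (rad y)) Wt Wr ft fr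
      Wtt Wtr Wrr ftt ftr frr x) {w v φ K P H G Φ : ℝ}
    (hw : w = W (x 0) (rad x)) (hv : v = f (x 0) (rad x)) (hφ : φ = v ^ 2 / rad x ^ 2)
    (hK : K = Wtt / w) (hP : P = ftt / v) (hH : H = (ftr - Wt x * fr x / w) / v)
    (hG : G = (frr - Wr x * fr x / w - w * Wt x * ft x) / v)
    (hΦ : Φ = (1 + ft x ^ 2 - fr x ^ 2 / w ^ 2) / v ^ 2) (k j : Fin (n + 1)) :
    ricci (sphericalMetric n W f) k j x =
      (-K - (n - 1) * P) * (dt k * dt j) + -(n - 1) * H * (dt k * dr x j)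
        + -(n - 1) * H * (dr x k * dt j) + (w ^ 2 * K - (n - 1) * G) * (dr x k * dr x j)
        + φ * (P - G / w ^ 2 + (n - 2) * Φ) * angProj x k j := by
  unfold ricci
  simp only [riemannUp_sphericalMetric h hw hv hφ hK hP hH hG hΦ]
  rw [(isSplitting h.firstJet.self_of_nhds.rad_pos.ne').sum_splitRiemann_trace]
  ring

lemma ricciScalar_sphericalMetric
    (h : HasSecondJet (fun y => W (y 0) (rad y)) (fun y => f (y 0) (rad y)) Wt Wr ft fr
      Wtt Wtr Wrr ftt ftr frr x) {w v K P G Φ : ℝ}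
    (hw : w = W (x 0) (rad x)) (hv : v = f (x 0) (rad x))
    (hK : K = Wtt / w) (hP : P = ftt / v)
    (hG : G = (frr - Wr x * fr x / w - w * Wt x * ft x) / v)
    (hΦ : Φ = (1 + ft x ^ 2 - fr x ^ 2 / w ^ 2) / v ^ 2) :
    ricciScalar (sphericalMetric n W f) x =
      2 * K + 2 * (n - 1) * (P - G / w ^ 2) + (n - 1) * (n - 2) * Φ := by
  have h1 := h.firstJet.self_of_nhds
  have hr := h1.rad_pos.ne'
  have hW : w ≠ 0 := hw ▸ h1.W_ne
  have hf : v ≠ 0 := hv ▸ h1.f_ne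
  unfold ricciScalar
  simp only [ricci_sphericalMetric h hw hv rfl hK hP rfl hG hΦ,
    sphericalMetric_inv hr h1.W_ne h1.f_ne, ← hw, ← hv]
  rw [(isSplitting hr).sum_inv_mul]
  field_simp
  ring

/-- Spherical symmetry leaves one independent component `κ`; tracelessness fixes the ratios of the
four coefficients. -/
lemma weyl_sphericalMetric (hn : 2 ≤ n)
    (h : HasSecondJet (fun y => W (y 0) (rad y)) (fun y => f (y 0) (rad y)) Wt Wr ft fr
      Wtt Wtr Wrr ftt ftr frr x) {w v φ K P G Φ κ : ℝ}
    (hw : w = W (x 0) (rad x)) (hv : v = f (x 0) (rad x)) (hφ : φ = v ^ 2 / rad x ^ 2)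
    (hK : K = Wtt / w) (hP : P = ftt / v)
    (hG : G = (frr - Wr x * fr x / w - w * Wt x * ft x) / v)
    (hΦ : Φ = (1 + ft x ^ 2 - fr x ^ 2 / w ^ 2) / v ^ 2)
    (hκ : κ = 2 * (K - P + G / w ^ 2 + Φ) / (n * (n - 1))) (a b c d : Fin (n + 1)) :
    weyl (sphericalMetric n W f) a b c d x = splitWeyl dt (dr x) (angProj x)
      (-((n - 1) * (n - 2) / 2) * w ^ 2 * κ) ((n - 2) / 2 * φ * κ) (-((n - 2) / 2) * w ^ 2 * φ * κ)
      (φ ^ 2 * κ) a b c d := by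
  have h1 := h.firstJet.self_of_nhds
  have hr := h1.rad_pos.ne'
  have hW : w ≠ 0 := hw ▸ h1.W_ne
  have hf : v ≠ 0 := hv ▸ h1.f_ne
  have hn' : (2 : ℝ) ≤ n := by exact_mod_cast hn
  have n0 : (n : ℝ) ≠ 0 := by positivity
  have n1 : (n : ℝ) - 1 ≠ 0 := by linarith
  have hφ0 : φ ≠ 0 := by rw [hφ]; positivity
  have S := isSplitting hr
  unfold weyl riemann
  simp only [ricci_sphericalMetric h hw hv hφ hK hP rfl hG hΦ,
    riemannUp_sphericalMetric h hw hv hφ hK hP rfl hG hΦ,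
    ricciScalar_sphericalMetric h hw hv hK hP hG hΦ, sphericalMetric_apply, ← hw, ← hv, ← hφ]
  rw [S.lower_splitRiemann]
  unfold splitRiemann splitWeyl
  -- The mixed tr quantity cancels between the Riemann and Ricci parts, so its form is irrelevant.
  generalize (ftr - Wt x * fr x / w) / v = Y
  push_cast
  rw [show (n : ℝ) + 1 - 2 = n - 1 by ring, show (n : ℝ) + 1 - 1 = n by ring, hκ, S.symm b c,
    S.symm a c]
  clear hK hP hG hΦ hκ hφ
  generalize (n : ℝ) = M at *
  field_simp
  ring

lemma weylSquared_sphericalMetric (hn : 2 ≤ n)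
    (h : HasSecondJet (fun y => W (y 0) (rad y)) (fun y => f (y 0) (rad y)) Wt Wr ft fr
      Wtt Wtr Wrr ftt ftr frr x) {w v K P G Φ : ℝ}
    (hw : w = W (x 0) (rad x)) (hv : v = f (x 0) (rad x))
    (hK : K = Wtt / w) (hP : P = ftt / v)
    (hG : G = (frr - Wr x * fr x / w - w * Wt x * ft x) / v)
    (hΦ : Φ = (1 + ft x ^ 2 - fr x ^ 2 / w ^ 2) / v ^ 2) :
    weylSquared (sphericalMetric n W f) x =
      4 * (n - 2) / n * (K - P + G / w ^ 2 + Φ) ^ 2 := by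
  have h1 := h.firstJet.self_of_nhds
  have hr := h1.rad_pos.ne'
  have hW : w ≠ 0 := hw ▸ h1.W_ne
  have hf : v ≠ 0 := hv ▸ h1.f_ne
  have hn' : (2 : ℝ) ≤ n := by exact_mod_cast hn
  have n0 : (n : ℝ) ≠ 0 := by positivity
  have n1 : (n : ℝ) - 1 ≠ 0 := by linarith
  have S := isSplitting hr
  have hC := weyl_sphericalMetric hn h hw hv rfl hK hP hG hΦ rfl
  have hg := sphericalMetric_inv hr h1.W_ne h1.f_ne
  simp only [← hw, ← hv] at hg
  -- The inner sums are nested so that `raise_splitWeyl` applies to them as they stand.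
  have e : ∀ a b c d, ∑ a', ∑ b', ∑ c', ∑ d',
      (sphericalMetric n W f x)⁻¹ a a' * (sphericalMetric n W f x)⁻¹ b b' *
        (sphericalMetric n W f x)⁻¹ c c' * (sphericalMetric n W f x)⁻¹ d d' *
      (weyl (sphericalMetric n W f) a b c d x * weyl (sphericalMetric n W f) a' b' c' d' x) =
      weyl (sphericalMetric n W f) a b c d x * ∑ a', (sphericalMetric n W f x)⁻¹ a a' *
        ∑ b', (sphericalMetric n W f x)⁻¹ b b' * ∑ c', (sphericalMetric n W f x)⁻¹ c c' *
        ∑ d', (sphericalMetric n W f x)⁻¹ d d' * weyl (sphericalMetric n W f) a' b' c' d' x := by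
    intro a b c d
    simp only [Finset.mul_sum]
    refine Finset.sum_congr rfl fun _ _ => Finset.sum_congr rfl fun _ _ =>
      Finset.sum_congr rfl fun _ _ => Finset.sum_congr rfl fun _ _ => ?_
    ring
  unfold weylSquared
  simp only [e]
  simp only [hC, hg, S.raise_splitWeyl, S.sum_splitWeyl_mul]
  generalize K - P + G / w ^ 2 + Φ = ψ
  clear hC hg e
  generalize (n : ℝ) = M at *
  field_simp
  ring

end

end KTCosmology

/-! ### Divergence criterion and time-dependent coefficients -/

namespace KTCosmology

open Topology Filter

section general

variable {n : ℕ}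

lemma HasTR.continuousAt {x : Fin (n + 1) → ℝ} {F : (Fin (n + 1) → ℝ) → ℝ} {u v : ℝ}
    (h : HasTR x F u v) : ContinuousAt F x :=
  HasFDerivAt.continuousAt h

@[fun_prop]
lemma continuous_rad : Continuous (rad : (Fin (n + 1) → ℝ) → ℝ) := by
  unfold rad; fun_prop

@[simp] lemma event_zero (ω : Fin n → ℝ) (t r : ℝ) : event ω t r 0 = t := rfl

@[simp] lemma event_succ (ω : Fin n → ℝ) (t r : ℝ) (i : Fin n) : event ω t r i.succ = r * ω i :=
  rfl

lemma rad_event {ω : Fin n → ℝ} (hω : ∑ i, ω i ^ 2 = 1) (t : ℝ) {r : ℝ} (hr : 0 ≤ r) :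
    rad (event ω t r) = r := by
  simp only [rad, event_succ, mul_pow, ← Finset.mul_sum, hω, mul_one, Real.sqrt_sq hr]

lemma continuous_event (ω : Fin n → ℝ) : Continuous fun p : ℝ × ℝ => event ω p.1 p.2 := by
  refine continuous_pi fun i => ?_
  refine Fin.cases ?_ (fun j => ?_) i
  · exact continuous_fst
  · exact continuous_snd.mul continuous_const

/-- Continuity of `M` and `D` at `p` in the full space, rather than along one curve, is what gives
divergence for every approach to `p` within `U`. -/
lemma divergesAt_of_eq_div {N : ℕ} {U : Set (Fin N → ℝ)} {S M D : (Fin N → ℝ) → ℝ} {p : Fin N → ℝ}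
    (hp : p ∈ closure U) (hpU : p ∉ U) (hM : ContinuousAt M p) (hM0 : M p ≠ 0)
    (hD : ContinuousAt D p) (hD0 : D p = 0)
    (h : ∀ᶠ x in 𝓝[U] p, D x ≠ 0 ∧ S x = M x / D x ^ 2) : DivergesAt U S p := by
  refine ⟨⟨hp, fun hi => hpU (interior_subset hi)⟩, ?_⟩
  have h1 : Tendsto (fun x => |M x|) (𝓝[U] p) (𝓝 |M p|) := (hM.abs).tendsto.mono_left inf_le_left
  have h2 : Tendsto (fun x => D x ^ 2) (𝓝[U] p) (𝓝[>] 0) := by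
    refine tendsto_nhdsWithin_iff.2 ⟨?_, h.mono fun x hx => by
      have := hx.1; exact Set.mem_Ioi.2 (by positivity)⟩
    have h3 : Tendsto (fun x => D x ^ 2) (𝓝 p) (𝓝 (D p ^ 2)) := hD.pow 2
    rw [hD0, zero_pow two_ne_zero] at h3
    exact h3.mono_left inf_le_left
  refine ((h1.pos_mul_atTop (abs_pos.2 hM0) (tendsto_inv_nhdsGT_zero.comp h2))).congr' ?_
  filter_upwards [h] with x hx
  rw [hx.2, abs_div, abs_of_nonneg (sq_nonneg (D x)), div_eq_mul_inv]
  rfl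

lemma mem_closure_of_radial {U : Set (Fin (n + 1) → ℝ)} {ω : Fin n → ℝ} {t R : ℝ} (hR : 0 < R)
    (h : ∀ r, 0 < r → r < R → event ω t r ∈ U) : event ω t R ∈ closure U := by
  have hc : Tendsto (fun r => event ω t r) (𝓝[<] R) (𝓝 (event ω t R)) :=
    (((continuous_event ω).comp (by fun_prop : Continuous fun r : ℝ => (t, r))).tendsto R).mono_left
      inf_le_left
  refine mem_closure_of_tendsto hc ?_
  filter_upwards [Ioo_mem_nhdsLT hR] with r hr using h r hr.1 hr.2

end general

/-- `a₁` and `a₂` are the first two derivatives of `a` on the set `I`, and `a₂` is continuous. -/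
structure HasTwoDerivs (I : Set ℝ) (a a₁ a₂ : ℝ → ℝ) : Prop where
  first : ∀ s ∈ I, HasDerivAt a (a₁ s) s
  second : ∀ s ∈ I, HasDerivAt a₁ (a₂ s) s
  cont : ∀ s ∈ I, ContinuousAt a₂ s

lemma hasTwoDerivs_of_contDiffOn {I : Set ℝ} (hI : IsOpen I) {a : ℝ → ℝ}
    (ha : ContDiffOn ℝ ((⊤ : ℕ∞) : WithTop ℕ∞) a I) :
    HasTwoDerivs I a (deriv a) (deriv (deriv a)) := by
  have h1 := (contDiffOn_infty_iff_deriv_of_isOpen hI).1 ha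
  have h2 := (contDiffOn_infty_iff_deriv_of_isOpen hI).1 h1.2
  exact ⟨fun s hs => (h1.1.differentiableAt (hI.mem_nhds hs)).hasDerivAt,
    fun s hs => (h2.1.differentiableAt (hI.mem_nhds hs)).hasDerivAt,
    fun s hs => h2.2.continuousOn.continuousAt (hI.mem_nhds hs)⟩

section time

variable {I : Set ℝ} {a a₁ a₂ : ℝ → ℝ} {n : ℕ} {x : Fin (n + 1) → ℝ}

lemma HasTwoDerivs.tr (h : HasTwoDerivs I a a₁ a₂) (hx : x 0 ∈ I) :
    HasTR x (fun y => a (y 0)) (a₁ (x 0)) 0 := HasTR.of_time (h.first _ hx)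

lemma HasTwoDerivs.tr' (h : HasTwoDerivs I a a₁ a₂) (hx : x 0 ∈ I) :
    HasTR x (fun y => a₁ (y 0)) (a₂ (x 0)) 0 := HasTR.of_time (h.second _ hx)

lemma HasTwoDerivs.continuousAt (h : HasTwoDerivs I a a₁ a₂) (hx : x 0 ∈ I) :
    ContinuousAt (fun y : Fin (n + 1) → ℝ => a (y 0)) x ∧
    ContinuousAt (fun y : Fin (n + 1) → ℝ => a₁ (y 0)) x ∧
    ContinuousAt (fun y : Fin (n + 1) → ℝ => a₂ (y 0)) x :=
  ⟨(h.tr hx).continuousAt, (h.tr' hx).continuousAt,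
    ContinuousAt.comp (f := fun y : Fin (n + 1) → ℝ => y 0) (h.cont _ hx) (continuousAt_apply 0 x)⟩

end time

/-! ### Curvature of the radial metric -/

section radial

variable {n : ℕ} {I : Set ℝ} {a a₁ a₂ k k₁ k₂ : ℝ → ℝ} {x : Fin (n + 1) → ℝ}

lemma hasTR_inv_sqrt (hk : HasTwoDerivs I k k₁ k₂) (hx : x 0 ∈ I) (hr : 0 < rad x)
    (hD : 0 < 1 - k (x 0) * rad x ^ 2) :
    HasTR x (fun y => (Real.sqrt (1 - k (y 0) * rad y ^ 2))⁻¹)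
      (1 / 2 * k₁ (x 0) * rad x ^ 2 * (Real.sqrt (1 - k (x 0) * rad x ^ 2))⁻¹ ^ 3)
      (k (x 0) * rad x * (Real.sqrt (1 - k (x 0) * rad x ^ 2))⁻¹ ^ 3) := by
  have h0 := Real.sqrt_pos.2 hD
  refine ((HasTR.comp (F := fun y => 1 - k (y 0) * rad y ^ 2) (Real.hasDerivAt_sqrt hD.ne')
    ((HasTR.const 1).sub ((hk.tr hx).mul ((HasTR.rad hr.ne').pow 2)))).inv h0.ne').congr ?_ ?_ <;>
  · field_simp
    try (push_cast; ring)

/-- Written with `E` = (1 - k r²)^(-1/2), all derivatives are polynomial, since each derivative of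
`E` is a polynomial multiple of `E`³. -/
lemma hasSecondJet_radial (ha : HasTwoDerivs I a a₁ a₂) (hk : HasTwoDerivs I k k₁ k₂)
    (hI : IsOpen I) (hapos : ∀ t ∈ I, 0 < a t)
    (hx : x 0 ∈ I) (hr : 0 < rad x) (hD : 0 < 1 - k (x 0) * rad x ^ 2)
    {E : (Fin (n + 1) → ℝ) → ℝ} (hE : E = fun y => (Real.sqrt (1 - k (y 0) * rad y ^ 2))⁻¹) :
    HasSecondJet (fun y => a (y 0) / Real.sqrt (1 - k (y 0) * rad y ^ 2))
      (fun y => a (y 0) * rad y)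
      (fun y => a₁ (y 0) * E y + 1 / 2 * (a (y 0) * k₁ (y 0)) * (rad y ^ 2 * E y ^ 3))
      (fun y => a (y 0) * k (y 0) * (rad y * E y ^ 3))
      (fun y => a₁ (y 0) * rad y) (fun y => a (y 0))
      (a₂ (x 0) * E x + a₁ (x 0) * k₁ (x 0) * rad x ^ 2 * E x ^ 3
        + 1 / 2 * a (x 0) * k₂ (x 0) * rad x ^ 2 * E x ^ 3
        + 3 / 4 * a (x 0) * k₁ (x 0) ^ 2 * rad x ^ 4 * E x ^ 5)
      (a₁ (x 0) * k (x 0) * rad x * E x ^ 3 + a (x 0) * k₁ (x 0) * rad x * E x ^ 3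
        + 3 / 2 * a (x 0) * k (x 0) * k₁ (x 0) * rad x ^ 3 * E x ^ 5)
      (a (x 0) * k (x 0) * E x ^ 3 + 3 * a (x 0) * k (x 0) ^ 2 * rad x ^ 2 * E x ^ 5)
      (a₂ (x 0) * rad x) (a₁ (x 0)) 0 x := by
  have hE' : ∀ {y : Fin (n + 1) → ℝ}, y 0 ∈ I → 0 < rad y → 0 < 1 - k (y 0) * rad y ^ 2 →
      HasTR y E (1 / 2 * k₁ (y 0) * rad y ^ 2 * E y ^ 3) (k (y 0) * rad y * E y ^ 3) := by
    subst hE; exact fun h1 h2 h3 => hasTR_inv_sqrt hk h1 h2 h3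
  have R := HasTR.rad hr.ne'
  have Ex := hE' hx hr hD
  have D' := (HasTR.const 1).sub ((hk.tr hx).mul (R.pow 2))
  refine ⟨?_, ?_, ?_, ?_, ?_⟩
  · filter_upwards [(continuousAt_apply 0 x).eventually_mem (hI.mem_nhds hx),
      R.continuousAt.eventually_const_lt hr, D'.continuousAt.eventually_const_lt hD] with y h1 h2 h3
    have A := (ha.tr h1)
    refine ⟨h2, (div_pos (hapos _ h1) (Real.sqrt_pos.2 h3)).ne', (mul_pos (hapos _ h1) h2).ne',
      ?_, ?_⟩
    · exact ((A.mul (hE' h1 h2 h3)).congr (by ring) (by ring)).congr_fun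
        fun z => by rw [hE]; exact div_eq_mul_inv _ _
    · exact (A.mul (HasTR.rad h2.ne')).congr (by ring) (by ring)
  · refine (((ha.tr' hx).mul Ex).add (((HasTR.const (1 / 2)).mul ((ha.tr hx).mul (hk.tr' hx))).mul
      ((R.pow 2).mul (Ex.pow 3)))).congr ?_ ?_ <;> (push_cast; ring)
  · refine (((ha.tr hx).mul (hk.tr hx)).mul (R.mul (Ex.pow 3))).congr ?_ ?_ <;> (push_cast; ring)
  · exact ((ha.tr' hx).mul R).congr (by ring) (by ring)
  · exact ha.tr hx

/-- `T` is D² W_tt/W. Its last term is the only one in either numerator that survives at `D` = 0. -/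
lemma curvature_radial (hn : 2 ≤ n) (ha : HasTwoDerivs I a a₁ a₂) (hk : HasTwoDerivs I k k₁ k₂)
    (hI : IsOpen I) (hapos : ∀ t ∈ I, 0 < a t)
    (hx : x 0 ∈ I) (hr : 0 < rad x) (hD : 0 < 1 - k (x 0) * rad x ^ 2) {T D b : ℝ}
    (hDe : D = 1 - k (x 0) * rad x ^ 2) (hb : b = a₁ (x 0) / a (x 0))
    (hT : T = a₂ (x 0) / a (x 0) * D ^ 2 + (b * k₁ (x 0) + 1 / 2 * k₂ (x 0)) * rad x ^ 2 * D
        + 3 / 4 * k₁ (x 0) ^ 2 * rad x ^ 4) :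
    ricciScalar (radialMetric n a k) x =
      (2 * T + 2 * (n - 1) * (a₂ (x 0) / a (x 0) * D ^ 2 + k (x 0) / a (x 0) ^ 2 * D ^ 2
          + b ^ 2 * D ^ 2 + 1 / 2 * b * k₁ (x 0) * rad x ^ 2 * D)
        + (n - 1) * (n - 2) * (b ^ 2 + k (x 0) / a (x 0) ^ 2) * D ^ 2) / D ^ 2 ∧
    weylSquared (radialMetric n a k) x = (4 * (n - 2) / n *
      (T - a₂ (x 0) / a (x 0) * D ^ 2 - 1 / 2 * b * k₁ (x 0) * rad x ^ 2 * D) ^ 2)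
        / (D ^ 2) ^ 2 := by
  have h := hasSecondJet_radial ha hk hI hapos hx hr hD rfl
  have hE : (Real.sqrt (1 - k (x 0) * rad x ^ 2))⁻¹ ^ 2 = D⁻¹ := by
    rw [inv_pow, Real.sq_sqrt hD.le, hDe]
  have hE0 : (Real.sqrt (1 - k (x 0) * rad x ^ 2))⁻¹ ≠ 0 := inv_ne_zero (Real.sqrt_pos.2 hD).ne'
  have hA := (hapos _ hx).ne'
  -- Eliminating k builds the relation between `E`, k and r into the formulas; what remains is a
  -- rational identity.
  have hkD : k (x 0) = (1 - D) / rad x ^ 2 := by rw [hDe]; field_simp; ring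
  have hD0 : D ≠ 0 := by rw [hDe]; exact hD.ne'
  have hW : a (x 0) / Real.sqrt (1 - k (x 0) * rad x ^ 2) =
    a (x 0) * (Real.sqrt (1 - k (x 0) * rad x ^ 2))⁻¹ := div_eq_mul_inv _ _
  unfold radialMetric
  rw [ricciScalar_sphericalMetric h hW.symm rfl rfl rfl rfl rfl,
    weylSquared_sphericalMetric hn h hW.symm rfl rfl rfl rfl rfl]
  clear h hW
  generalize (Real.sqrt (1 - k (x 0) * rad x ^ 2))⁻¹ = E at *
  have hDE : D = (E ^ 2)⁻¹ := by rw [hE, inv_inv]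
  rw [hT, hb, hkD, hDE]
  clear hT hb hkD hDE hE hDe hD hD0
  constructor
  · field_simp
    ring
  · rw [mul_div_assoc (4 * ((n : ℝ) - 2) / n), ← div_pow _ ((E ^ 2)⁻¹ ^ 2)]
    congr 2
    field_simp
    ring

end radial

end KTCosmology

namespace KTCosmology

open Topology Filter

/-! ### Boundary of the radial domain and divergence there -/

section radial

variable {n : ℕ} {I : Set ℝ} {a a₁ a₂ k k₁ k₂ : ℝ → ℝ}

lemma mem_of_lt_divSqrt {P : Prop} {c C r : ℝ} (hC : 0 < C) :
    (P ∧ 0 < r ∧ (r : EReal) < divSqrt c C) ↔ P ∧ 0 < r ∧ r < c / Real.sqrt C := by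
  rw [divSqrt, if_pos hC, EReal.coe_lt_coe_iff]

lemma lt_one_div_sqrt {C r : ℝ} (hC : 0 < C) (hr : 0 < r) :
    r < 1 / Real.sqrt C ↔ 0 < 1 - C * r ^ 2 := by
  have h := Real.sqrt_pos.2 hC
  rw [lt_div_iff₀ h, ← sq_lt_one_iff₀ (by positivity), mul_pow, Real.sq_sqrt hC.le, sub_pos,
    mul_comm]

lemma one_sub_mul_sq {C : ℝ} (hC : 0 < C) : 1 - C * (1 / Real.sqrt C) ^ 2 = 0 := by
  rw [div_pow, one_pow, Real.sq_sqrt hC.le]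
  field_simp
  simp

lemma mem_radialDomain {x : Fin (n + 1) → ℝ} (hk : 0 < k (x 0)) :
    x ∈ radialDomain n I k ↔ x 0 ∈ I ∧ 0 < rad x ∧ 0 < 1 - k (x 0) * rad x ^ 2 := by
  unfold radialDomain
  rw [Set.mem_ofPred_eq, mem_of_lt_divSqrt hk]
  refine and_congr_right fun _ => and_congr_right fun hr => lt_one_div_sqrt hk hr

lemma HasTwoDerivs.eventually_pos (hk : HasTwoDerivs I k k₁ k₂) (hI : IsOpen I)
    {p : Fin (n + 1) → ℝ} (hp : p 0 ∈ I) (hkp : 0 < k (p 0)) :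
    ∀ᶠ x in 𝓝 p, x 0 ∈ I ∧ 0 < k (x 0) :=
  ((continuousAt_apply 0 p).eventually_mem (hI.mem_nhds hp)).and
    ((hk.tr hp).continuousAt.eventually_const_lt hkp)

lemma radial_closure {ω : Fin n → ℝ} (hω : ∑ i, ω i ^ 2 = 1) {t : ℝ} (ht : t ∈ I) (hkt : 0 < k t) :
    event ω t (1 / Real.sqrt (k t)) ∈ closure (radialDomain n I k) ∧
      event ω t (1 / Real.sqrt (k t)) ∉ radialDomain n I k := by
  have hR : 0 < 1 / Real.sqrt (k t) := one_div_pos.2 (Real.sqrt_pos.2 hkt)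
  constructor
  · refine mem_closure_of_radial hR fun r h1 h2 => (mem_radialDomain hkt).2 ?_
    rw [rad_event hω t h1.le]
    exact ⟨ht, h1, (lt_one_div_sqrt hkt h1).1 h2⟩
  · intro h
    have := ((mem_radialDomain hkt).1 h).2.2
    rw [rad_event hω t hR.le, event_zero, one_sub_mul_sq hkt] at this
    exact this.false

/-! ### Continuity of the cleared numerators at the boundary -/

section continuity

variable {A A₁ A₂ K K₁ K₂ : (Fin (n + 1) → ℝ) → ℝ} {p : Fin (n + 1) → ℝ}

lemma continuousAt_radial_ricci (c : ℝ) (hA : ContinuousAt A p) (hA₁ : ContinuousAt A₁ p)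
    (hA₂ : ContinuousAt A₂ p) (hK : ContinuousAt K p) (hK₁ : ContinuousAt K₁ p)
    (hK₂ : ContinuousAt K₂ p) (h0 : A p ≠ 0) :
    ContinuousAt (fun x => 2 * (A₂ x / A x * (1 - K x * rad x ^ 2) ^ 2
        + (A₁ x / A x * K₁ x + 1 / 2 * K₂ x) * rad x ^ 2 * (1 - K x * rad x ^ 2)
        + 3 / 4 * K₁ x ^ 2 * rad x ^ 4)
      + 2 * (c - 1) * (A₂ x / A x * (1 - K x * rad x ^ 2) ^ 2
        + K x / A x ^ 2 * (1 - K x * rad x ^ 2) ^ 2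
        + (A₁ x / A x) ^ 2 * (1 - K x * rad x ^ 2) ^ 2
        + 1 / 2 * (A₁ x / A x) * K₁ x * rad x ^ 2 * (1 - K x * rad x ^ 2))
      + (c - 1) * (c - 2) * ((A₁ x / A x) ^ 2 + K x / A x ^ 2) * (1 - K x * rad x ^ 2) ^ 2) p := by
  have h0' : A p ^ 2 ≠ 0 := pow_ne_zero 2 h0
  fun_prop (disch := assumption)

lemma continuousAt_radial_weyl (c : ℝ) (hA : ContinuousAt A p) (hA₁ : ContinuousAt A₁ p)
    (hA₂ : ContinuousAt A₂ p) (hK : ContinuousAt K p) (hK₁ : ContinuousAt K₁ p)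
    (hK₂ : ContinuousAt K₂ p) (h0 : A p ≠ 0) :
    ContinuousAt (fun x => 4 * (c - 2) / c * (A₂ x / A x * (1 - K x * rad x ^ 2) ^ 2
        + (A₁ x / A x * K₁ x + 1 / 2 * K₂ x) * rad x ^ 2 * (1 - K x * rad x ^ 2)
        + 3 / 4 * K₁ x ^ 2 * rad x ^ 4 - A₂ x / A x * (1 - K x * rad x ^ 2) ^ 2
        - 1 / 2 * (A₁ x / A x) * K₁ x * rad x ^ 2 * (1 - K x * rad x ^ 2)) ^ 2) p := by
  fun_prop (disch := assumption)

lemma continuousAt_conformal_ricci (c : ℝ) (hA : ContinuousAt A p) (hA₁ : ContinuousAt A₁ p)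
    (hA₂ : ContinuousAt A₂ p) (hK : ContinuousAt K p) (hK₁ : ContinuousAt K₁ p)
    (hK₂ : ContinuousAt K₂ p) (h0 : A p ≠ 0) :
    ContinuousAt (fun x => 2 * (A₂ x / A x * (1 + K x * rad x ^ 2) ^ 2
        - (2 * (A₁ x / A x) * K₁ x + K₂ x) * rad x ^ 2 * (1 + K x * rad x ^ 2)
        + 2 * K₁ x ^ 2 * rad x ^ 4)
      + 2 * (c - 1) * (A₂ x / A x * (1 + K x * rad x ^ 2) ^ 2
        - (2 * (A₁ x / A x) * K₁ x + K₂ x) * rad x ^ 2 * (1 + K x * rad x ^ 2)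
        + 2 * K₁ x ^ 2 * rad x ^ 4 + K x / A x ^ 2 * (1 + K x * rad x ^ 2) ^ 2
        + (A₁ x / A x * (1 + K x * rad x ^ 2) - K₁ x * rad x ^ 2) ^ 2)
      + (c - 1) * (c - 2) * ((A₁ x / A x * (1 + K x * rad x ^ 2) - K₁ x * rad x ^ 2) ^ 2
        + K x / A x ^ 2 * (1 + K x * rad x ^ 2) ^ 2)) p := by
  have h0' : A p ^ 2 ≠ 0 := pow_ne_zero 2 h0
  fun_prop (disch := assumption)

end continuity

lemma radial_divergesAt (hn : 3 ≤ n) (ha : HasTwoDerivs I a a₁ a₂) (hk : HasTwoDerivs I k k₁ k₂)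
    (hI : IsOpen I) (hapos : ∀ t ∈ I, 0 < a t) {ω : Fin n → ℝ} (hω : ∑ i, ω i ^ 2 = 1) {t : ℝ}
    (ht : t ∈ I) (hkt : 0 < k t) (hk₁ : k₁ t ≠ 0) :
    DivergesAt (radialDomain n I k) (ricciScalar (radialMetric n a k))
      (event ω t (1 / Real.sqrt (k t))) ∧
    DivergesAt (radialDomain n I k) (weylSquared (radialMetric n a k))
      (event ω t (1 / Real.sqrt (k t))) := by
  obtain ⟨hp, hpU⟩ := radial_closure (I := I) hω ht hkt
  have hR : 0 < 1 / Real.sqrt (k t) := one_div_pos.2 (Real.sqrt_pos.2 hkt)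
  have hrp := rad_event hω t hR.le
  have hD0 := one_sub_mul_sq hkt
  set R := 1 / Real.sqrt (k t)
  set p := event ω t R with hpdef
  have hp0 : p 0 = t := rfl
  have hpI : p 0 ∈ I := ht
  obtain ⟨ca, ca₁, ca₂⟩ := ha.continuousAt hpI
  obtain ⟨ck, ck₁, ck₂⟩ := hk.continuousAt hpI
  have ha0 : a (p 0) ≠ 0 := (hapos _ hpI).ne'
  have hn' : (3 : ℝ) ≤ n := by exact_mod_cast hn
  have cD : ContinuousAt (fun x : Fin (n + 1) → ℝ => 1 - k (x 0) * rad x ^ 2) p :=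
    continuousAt_const.sub (ck.mul (continuous_rad.continuousAt.pow 2))
  have key : ∀ᶠ x in 𝓝[radialDomain n I k] p, x 0 ∈ I ∧ 0 < rad x ∧ 0 < 1 - k (x 0) * rad x ^ 2 := by
    filter_upwards [self_mem_nhdsWithin, nhdsWithin_le_nhds (hk.eventually_pos hI hpI hkt)]
      with x h1 h2 using (mem_radialDomain h2.2).1 h1
  have hc : 0 < k₁ t ^ 2 * R ^ 4 := by positivity
  constructor
  · refine divergesAt_of_eq_div (D := fun x => 1 - k (x 0) * rad x ^ 2) hp hpU ?_ ?_ cD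
      (by rw [hp0, hrp, hD0]) (key.mono fun x hx => ⟨hx.2.2.ne',
      (curvature_radial (by lia) ha hk hI hapos hx.1 hx.2.1 hx.2.2 rfl rfl rfl).1⟩)
    · exact continuousAt_radial_ricci n ca ca₁ ca₂ ck ck₁ ck₂ ha0
    · rw [hp0, hrp, hD0]
      nlinarith
  -- The Weyl scalar blows up like D⁻⁴, so the criterion, which squares its denominator, is applied
  -- to D².
  · refine divergesAt_of_eq_div (D := fun x => (1 - k (x 0) * rad x ^ 2) ^ 2) hp hpU ?_ ?_
      (cD.pow 2)
      (by rw [hp0, hrp, hD0]; simp) (key.mono fun x hx => ⟨(pow_pos hx.2.2 2).ne',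
      (curvature_radial (by lia) ha hk hI hapos hx.1 hx.2.1 hx.2.2 rfl rfl rfl).2⟩)
    · exact continuousAt_radial_weyl n ca ca₁ ca₂ ck ck₁ ck₂ ha0
    · rw [hp0, hrp, hD0]
      have : (n : ℝ) - 2 ≠ 0 := by linarith
      have : (n : ℝ) ≠ 0 := by linarith
      simp only [ne_eq, mul_zero, zero_pow two_ne_zero, zero_add, sub_zero]
      positivity

end radial

/-! ### The conformal metric -/

section conformal

variable {n : ℕ} {I : Set ℝ} {a a₁ a₂ k k₁ k₂ : ℝ → ℝ} {x : Fin (n + 1) → ℝ}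

lemma hasTR_inv_one_add (hk : HasTwoDerivs I k k₁ k₂) (hx : x 0 ∈ I) (hr : 0 < rad x)
    (hD : 0 < 1 + k (x 0) * rad x ^ 2) :
    HasTR x (fun y => (1 + k (y 0) * rad y ^ 2)⁻¹)
      (-k₁ (x 0) * rad x ^ 2 * (1 + k (x 0) * rad x ^ 2)⁻¹ ^ 2)
      (-2 * k (x 0) * rad x * (1 + k (x 0) * rad x ^ 2)⁻¹ ^ 2) := by
  refine (((HasTR.const 1).add ((hk.tr hx).mul ((HasTR.rad hr.ne').pow 2))).inv hD.ne').congr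
    ?_ ?_ <;>
  · field_simp
    try (push_cast; ring)

lemma hasSecondJet_conformal (ha : HasTwoDerivs I a a₁ a₂) (hk : HasTwoDerivs I k k₁ k₂)
    (hI : IsOpen I) (hapos : ∀ t ∈ I, 0 < a t)
    (hx : x 0 ∈ I) (hr : 0 < rad x) (hD : 0 < 1 + k (x 0) * rad x ^ 2)
    {E Wt Wr : (Fin (n + 1) → ℝ) → ℝ} (hE : E = fun y => (1 + k (y 0) * rad y ^ 2)⁻¹)
    (hWt : Wt = fun y => 2 * (a₁ (y 0) * E y) + -2 * (a (y 0) * k₁ (y 0)) * (rad y ^ 2 * E y ^ 2))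
    (hWr : Wr = fun y => -4 * (a (y 0) * k (y 0)) * (rad y * E y ^ 2))
    {Wtt Wtr Wrr : ℝ}
    (hWtt : Wtt = 2 * a₂ (x 0) * E x - 4 * a₁ (x 0) * k₁ (x 0) * rad x ^ 2 * E x ^ 2
        - 2 * a (x 0) * k₂ (x 0) * rad x ^ 2 * E x ^ 2
        + 4 * a (x 0) * k₁ (x 0) ^ 2 * rad x ^ 4 * E x ^ 3)
    (hWtr : Wtr = -4 * a₁ (x 0) * k (x 0) * rad x * E x ^ 2
        - 4 * a (x 0) * k₁ (x 0) * rad x * E x ^ 2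
        + 8 * a (x 0) * k (x 0) * k₁ (x 0) * rad x ^ 3 * E x ^ 3)
    (hWrr : Wrr = -4 * a (x 0) * k (x 0) * E x ^ 2
        + 16 * a (x 0) * k (x 0) ^ 2 * rad x ^ 2 * E x ^ 3) :
    HasSecondJet (fun y => 2 * a (y 0) / (1 + k (y 0) * rad y ^ 2))
      (fun y => 2 * a (y 0) / (1 + k (y 0) * rad y ^ 2) * rad y)
      Wt Wr (fun y => Wt y * rad y)
      (fun y => Wr y * rad y + 2 * (a (y 0) * E y))
      Wtt Wtr Wrr (Wtt * rad x) (Wtr * rad x + Wt x) (Wrr * rad x + 2 * Wr x) x := by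
  have hE' : ∀ {y : Fin (n + 1) → ℝ}, y 0 ∈ I → 0 < rad y → 0 < 1 + k (y 0) * rad y ^ 2 →
      HasTR y E (-k₁ (y 0) * rad y ^ 2 * E y ^ 2) (-2 * k (y 0) * rad y * E y ^ 2) := by
    subst hE; exact fun h1 h2 h3 => hasTR_inv_one_add hk h1 h2 h3
  have R := HasTR.rad hr.ne'
  have Ex := hE' hx hr hD
  have D' := (HasTR.const 1).add ((hk.tr hx).mul (R.pow 2))
  have Wt' : HasTR x Wt Wtt Wtr := by
    subst hWt hWtt hWtr
    refine (((HasTR.const 2).mul ((ha.tr' hx).mul Ex)).add (((HasTR.const (-2)).mul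
      ((ha.tr hx).mul (hk.tr' hx))).mul ((R.pow 2).mul (Ex.pow 2)))).congr ?_ ?_ <;>
    (push_cast; ring)
  have Wr' : HasTR x Wr Wtr Wrr := by
    subst hWr hWtr hWrr
    refine (((HasTR.const (-4)).mul ((ha.tr hx).mul (hk.tr hx))).mul
      (R.mul (Ex.pow 2))).congr ?_ ?_ <;> (push_cast; ring)
  refine ⟨?_, Wt', Wr', ?_, ?_⟩
  · filter_upwards [(continuousAt_apply 0 x).eventually_mem (hI.mem_nhds hx),
      R.continuousAt.eventually_const_lt hr, D'.continuousAt.eventually_const_lt hD] with y h1 h2 h3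
    have hW : HasTR y (fun y => 2 * a (y 0) / (1 + k (y 0) * rad y ^ 2)) (Wt y) (Wr y) := by
      refine (((HasTR.const 2).mul ((ha.tr h1).mul (hE' h1 h2 h3))).congr ?_ ?_).congr_fun
        fun z => ?_
      · rw [hWt]; ring
      · rw [hWr]; ring
      · rw [hE, div_eq_mul_inv, mul_assoc]
    refine ⟨h2, (div_pos (mul_pos two_pos (hapos _ h1)) h3).ne',
      (mul_pos (div_pos (mul_pos two_pos (hapos _ h1)) h3) h2).ne', hW, ?_⟩
    refine (hW.mul (HasTR.rad h2.ne')).congr (by ring) ?_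
    rw [hE]
    simp only [div_eq_mul_inv]
    ring
  · exact (Wt'.mul R).congr (by ring) (by ring)
  · refine ((Wr'.mul R).add ((HasTR.const 2).mul ((ha.tr hx).mul Ex))).congr ?_ ?_
    · subst hWt; ring
    · subst hWr; ring

/-- `T` is D² W_tt/W and `V` is D W_t/W. As f = r W, the same quantities also give f_tt/f and f_t/f.
-/
lemma curvature_conformal (ha : HasTwoDerivs I a a₁ a₂) (hk : HasTwoDerivs I k k₁ k₂)
    (hI : IsOpen I) (hapos : ∀ t ∈ I, 0 < a t)
    (hx : x 0 ∈ I) (hr : 0 < rad x) (hD : 0 < 1 + k (x 0) * rad x ^ 2) {T V D b : ℝ}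
    (hDe : D = 1 + k (x 0) * rad x ^ 2) (hb : b = a₁ (x 0) / a (x 0))
    (hT : T = a₂ (x 0) / a (x 0) * D ^ 2 - (2 * b * k₁ (x 0) + k₂ (x 0)) * rad x ^ 2 * D
        + 2 * k₁ (x 0) ^ 2 * rad x ^ 4)
    (hV : V = b * D - k₁ (x 0) * rad x ^ 2) :
    ricciScalar (conformalMetric n a k) x =
      (2 * T + 2 * (n - 1) * (T + k (x 0) / a (x 0) ^ 2 * D ^ 2 + V ^ 2)
        + (n - 1) * (n - 2) * (V ^ 2 + k (x 0) / a (x 0) ^ 2 * D ^ 2)) / D ^ 2 := by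
  have h := hasSecondJet_conformal ha hk hI hapos hx hr hD rfl rfl rfl rfl rfl rfl
  have hA := (hapos _ hx).ne'
  have hkD : k (x 0) = (D - 1) / rad x ^ 2 := by rw [hDe]; field_simp; ring
  have hD0 : D ≠ 0 := by rw [hDe]; exact hD.ne'
  unfold conformalMetric
  rw [ricciScalar_sphericalMetric h rfl rfl rfl rfl rfl rfl]
  simp only [← hDe]
  rw [hT, hV, hb, hkD]
  field_simp
  ring

lemma HasTwoDerivs.neg (hk : HasTwoDerivs I k k₁ k₂) :
    HasTwoDerivs I (fun s => -k s) (fun s => -k₁ s) (fun s => -k₂ s) :=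
  ⟨fun s hs => (hk.first s hs).neg, fun s hs => (hk.second s hs).neg, fun s hs => (hk.cont s hs).neg⟩

/-- Lets the boundary geometry and the crossing argument of the radial case be reused with -k. -/
lemma conformalDomain_eq : conformalDomain n I k = radialDomain n I (fun s => -k s) := rfl

lemma conformal_divergesAt (hn : 3 ≤ n) (ha : HasTwoDerivs I a a₁ a₂) (hk : HasTwoDerivs I k k₁ k₂)
    (hI : IsOpen I) (hapos : ∀ t ∈ I, 0 < a t) {ω : Fin n → ℝ} (hω : ∑ i, ω i ^ 2 = 1) {t : ℝ}
    (ht : t ∈ I) (hkt : k t < 0) (hk₁ : k₁ t ≠ 0) :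
    DivergesAt (conformalDomain n I k) (ricciScalar (conformalMetric n a k))
      (event ω t (1 / Real.sqrt (-k t))) := by
  have hkt' : 0 < -k t := neg_pos.2 hkt
  rw [conformalDomain_eq]
  obtain ⟨hp, hpU⟩ := radial_closure (I := I) (k := fun s => -k s) hω ht hkt'
  have hR : 0 < 1 / Real.sqrt (-k t) := one_div_pos.2 (Real.sqrt_pos.2 hkt')
  have hrp := rad_event hω t hR.le
  have hD0 := one_sub_mul_sq hkt'
  rw [neg_mul, sub_neg_eq_add] at hD0
  set R := 1 / Real.sqrt (-k t)
  set p := event ω t R with hpdef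
  have hp0 : p 0 = t := rfl
  have hpI : p 0 ∈ I := ht
  obtain ⟨ca, ca₁, ca₂⟩ := ha.continuousAt hpI
  obtain ⟨ck, ck₁, ck₂⟩ := hk.continuousAt hpI
  have ha0 : a (p 0) ≠ 0 := (hapos _ hpI).ne'
  have hn' : (3 : ℝ) ≤ n := by exact_mod_cast hn
  have cD : ContinuousAt (fun x : Fin (n + 1) → ℝ => 1 + k (x 0) * rad x ^ 2) p :=
    continuousAt_const.add (ck.mul (continuous_rad.continuousAt.pow 2))
  have hc : 0 < k₁ t ^ 2 * R ^ 4 := by positivity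
  refine divergesAt_of_eq_div (D := fun x => 1 + k (x 0) * rad x ^ 2) hp hpU
    (continuousAt_conformal_ricci n ca ca₁ ca₂ ck ck₁ ck₂ ha0) ?_ cD (by rw [hp0, hrp, hD0]) ?_
  · rw [hp0, hrp, hD0]
    -- At D = 0 one has T = 2 k'² R⁴ and V² = k'² R⁴, and 4 + 6(n-1) + (n-1)(n-2) = n(n+3).
    have : 0 < (n : ℝ) * (n + 3) * (k₁ t ^ 2 * R ^ 4) := by positivity
    nlinarith
  · filter_upwards [self_mem_nhdsWithin, nhdsWithin_le_nhds (hk.neg.eventually_pos hI hpI hkt')]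
      with x h1 h2
    obtain ⟨h3, h4, h5⟩ := (mem_radialDomain (k := fun s => -k s) h2.2).1 h1
    rw [neg_mul, sub_neg_eq_add] at h5
    exact ⟨h5.ne', curvature_conformal ha hk hI hapos h3 h4 h5 rfl rfl rfl rfl⟩

end conformal

end KTCosmology

namespace KTCosmology

open Topology Filter

/-! ### The warped metric -/

section warped

variable {n : ℕ} {I : Set ℝ} {a a₁ a₂ k k₁ k₂ : ℝ → ℝ} {x : Fin (n + 1) → ℝ}

lemma hasTR_sqrt_mul_rad (hk : HasTwoDerivs I k k₁ k₂) (hx : x 0 ∈ I) (hkx : 0 < k (x 0))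
    (hr : 0 < rad x) :
    HasTR x (fun y => Real.sqrt (k (y 0)) * rad y)
      (k₁ (x 0) * rad x / (2 * Real.sqrt (k (x 0)))) (Real.sqrt (k (x 0))) :=
  ((HasTR.comp (F := fun y => k (y 0)) (Real.hasDerivAt_sqrt hkx.ne') (hk.tr hx)).mul
    (HasTR.rad hr.ne')).congr (by field_simp; ring) (by ring)

lemma hasTR_cos (hk : HasTwoDerivs I k k₁ k₂) (hx : x 0 ∈ I) (hkx : 0 < k (x 0)) (hr : 0 < rad x) :
    HasTR x (fun y => Real.cos (Real.sqrt (k (y 0)) * rad y))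
      (-(k₁ (x 0) * rad x * sk (k (x 0)) (rad x) / 2)) (-(k (x 0) * sk (k (x 0)) (rad x))) := by
  have h0 := Real.sqrt_pos.2 hkx
  refine (HasTR.comp (F := fun y => Real.sqrt (k (y 0)) * rad y) (Real.hasDerivAt_cos _)
    (hasTR_sqrt_mul_rad hk hx hkx hr)).congr ?_ ?_
  · rw [sk, if_pos hkx]; field_simp
  · rw [sk, if_pos hkx]; field_simp; rw [Real.sq_sqrt hkx.le, mul_comm]

lemma hasTR_sk (hk : HasTwoDerivs I k k₁ k₂) (hI : IsOpen I) (hx : x 0 ∈ I) (hkx : 0 < k (x 0))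
    (hr : 0 < rad x) :
    HasTR x (fun y => sk (k (y 0)) (rad y))
      (k₁ (x 0) * (rad x * Real.cos (Real.sqrt (k (x 0)) * rad x) - sk (k (x 0)) (rad x))
        / (2 * k (x 0))) (Real.cos (Real.sqrt (k (x 0)) * rad x)) := by
  have h0 := Real.sqrt_pos.2 hkx
  have h2 := Real.sq_sqrt hkx.le
  -- Since k stays positive near the point, only the sine branch of `sk` matters.
  refine HasTR.congr_of_eventuallyEq (F := fun y => Real.sin (Real.sqrt (k (y 0)) * rad y) /
    Real.sqrt (k (y 0))) ?_ ((hk.eventually_pos hI hx hkx).mono fun y hy => if_pos hy.2)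
  refine ((HasTR.comp (F := fun y => Real.sqrt (k (y 0)) * rad y) (Real.hasDerivAt_sin _)
    (hasTR_sqrt_mul_rad hk hx hkx hr)).div (HasTR.comp (F := fun y => k (y 0))
    (Real.hasDerivAt_sqrt hkx.ne') (hk.tr hx)) h0.ne').congr ?_ ?_
  · rw [sk, if_pos hkx, h2]
    field_simp
  · field_simp
    ring

lemma hasSecondJet_warped (ha : HasTwoDerivs I a a₁ a₂) (hk : HasTwoDerivs I k k₁ k₂)
    (hI : IsOpen I) (hapos : ∀ t ∈ I, 0 < a t)
    (hx : x 0 ∈ I) (hkx : 0 < k (x 0)) (hr : 0 < rad x) (hS : sk (k (x 0)) (rad x) ≠ 0)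
    {S C St : (Fin (n + 1) → ℝ) → ℝ} (hSe : S = fun y => sk (k (y 0)) (rad y))
    (hCe : C = fun y => Real.cos (Real.sqrt (k (y 0)) * rad y))
    (hSt : St = fun y => k₁ (y 0) * (rad y * C y - S y) / (2 * k (y 0))) {Stt : ℝ}
    (hStt : Stt = k₂ (x 0) * (rad x * C x - S x) / (2 * k (x 0))
      - k₁ (x 0) * (k₁ (x 0) * rad x ^ 2 * S x / 2 + St x) / (2 * k (x 0))
      - k₁ (x 0) ^ 2 * (rad x * C x - S x) / (2 * k (x 0) ^ 2)) :
    HasSecondJet (fun y => a (y 0)) (fun y => a (y 0) * sk (k (y 0)) (rad y))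
      (fun y => a₁ (y 0)) (fun _ => 0)
      (fun y => a₁ (y 0) * S y + a (y 0) * St y) (fun y => a (y 0) * C y)
      (a₂ (x 0)) 0 0 (a₂ (x 0) * S x + 2 * a₁ (x 0) * St x + a (x 0) * Stt)
      (a₁ (x 0) * C x - a (x 0) * (k₁ (x 0) * rad x * S x / 2)) (-(a (x 0) * k (x 0) * S x)) x := by
  have R := HasTR.rad hr.ne'
  have S' : ∀ {y : Fin (n + 1) → ℝ}, y 0 ∈ I → 0 < k (y 0) → 0 < rad y → HasTR y S (St y) (C y) := by
    subst hSt hSe hCe; exact fun h1 h2 h3 => hasTR_sk hk hI h1 h2 h3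
  have C' : HasTR x C (-(k₁ (x 0) * rad x * S x / 2)) (-(k (x 0) * S x)) := by
    subst hSe hCe; exact hasTR_cos hk hx hkx hr
  have Sx := S' hx hkx hr
  have St' : HasTR x St Stt (-(k₁ (x 0) * rad x * S x / 2)) := by
    have h := (((hk.tr' hx).mul ((R.mul C').sub Sx)).div ((HasTR.const 2).mul (hk.tr hx))
      (mul_ne_zero two_ne_zero hkx.ne'))
    refine (h.congr_fun fun y => by rw [hSt]).congr ?_ ?_
    · rw [hStt]; field_simp; ring
    · field_simp; ring
  refine ⟨?_, ha.tr' hx, HasTR.const 0, ?_, ?_⟩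
  · have hS' : S x ≠ 0 := by rw [hSe]; exact hS
    filter_upwards [hk.eventually_pos hI hx hkx, R.continuousAt.eventually_const_lt hr,
      Sx.continuousAt.eventually_ne hS'] with y h1 h2 h3
    have A := ha.tr h1.1
    have h := A.mul (S' h1.1 h1.2 h2)
    rw [hSe] at h h3
    refine ⟨h2, (hapos _ h1.1).ne', mul_ne_zero (hapos _ h1.1).ne' h3, A, ?_⟩
    rw [hSe]
    exact h.congr rfl (by ring)
  · exact (((ha.tr' hx).mul Sx).add ((ha.tr hx).mul St')).congr (by ring) (by ring)
  · exact ((ha.tr hx).mul C').congr (by ring) (by ring)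

lemma curvature_warped (ha : HasTwoDerivs I a a₁ a₂) (hk : HasTwoDerivs I k k₁ k₂)
    (hI : IsOpen I) (hapos : ∀ t ∈ I, 0 < a t)
    (hx : x 0 ∈ I) (hkx : 0 < k (x 0)) (hr : 0 < rad x) {S C St Stt F : ℝ} (hS : S ≠ 0)
    (hSe : S = sk (k (x 0)) (rad x)) (hCe : C = Real.cos (Real.sqrt (k (x 0)) * rad x))
    (hSt : St = k₁ (x 0) * (rad x * C - S) / (2 * k (x 0)))
    (hStt : Stt = k₂ (x 0) * (rad x * C - S) / (2 * k (x 0))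
      - k₁ (x 0) * (k₁ (x 0) * rad x ^ 2 * S / 2 + St) / (2 * k (x 0))
      - k₁ (x 0) ^ 2 * (rad x * C - S) / (2 * k (x 0) ^ 2))
    (hF : F = a₁ (x 0) * S + a (x 0) * St) :
    ricciScalar (warpedMetric n a k) x =
      (2 * (a₂ (x 0) * a (x 0)) * S ^ 2 + 2 * (n - 1) * (S *
        ((a₂ (x 0) * S + 2 * a₁ (x 0) * St + a (x 0) * Stt) * a (x 0) + k (x 0) * S
          + a₁ (x 0) * F)) + (n - 1) * (n - 2) * (1 + F ^ 2 - C ^ 2)) / (a (x 0) * S) ^ 2 := by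
  have h := hasSecondJet_warped ha hk hI hapos hx hkx hr (hSe ▸ hS) rfl rfl rfl rfl
  have hA := (hapos _ hx).ne'
  unfold warpedMetric
  rw [ricciScalar_sphericalMetric h rfl rfl rfl rfl rfl rfl]
  simp only [← hSe, ← hCe, ← hSt, ← hStt, ← hF]
  field_simp
  ring

lemma continuousAt_warped_ricci {A A₁ A₂ K K₁ K₂ S C : (Fin (n + 1) → ℝ) → ℝ}
    {p : Fin (n + 1) → ℝ} (c : ℝ) (hA : ContinuousAt A p) (hA₁ : ContinuousAt A₁ p)
    (hA₂ : ContinuousAt A₂ p) (hK : ContinuousAt K p) (hK₁ : ContinuousAt K₁ p)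
    (hK₂ : ContinuousAt K₂ p) (hS : ContinuousAt S p) (hC : ContinuousAt C p) (h0 : K p ≠ 0) :
    ContinuousAt (fun x => 2 * (A₂ x * A x) * S x ^ 2 + 2 * (c - 1) * (S x *
        ((A₂ x * S x + 2 * A₁ x * (K₁ x * (rad x * C x - S x) / (2 * K x))
          + A x * (K₂ x * (rad x * C x - S x) / (2 * K x)
            - K₁ x * (K₁ x * rad x ^ 2 * S x / 2 + K₁ x * (rad x * C x - S x) / (2 * K x))
              / (2 * K x)
            - K₁ x ^ 2 * (rad x * C x - S x) / (2 * K x ^ 2))) * A x + K x * S x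
          + A₁ x * (A₁ x * S x + A x * (K₁ x * (rad x * C x - S x) / (2 * K x)))))
      + (c - 1) * (c - 2) *
        (1 + (A₁ x * S x + A x * (K₁ x * (rad x * C x - S x) / (2 * K x))) ^ 2 - C x ^ 2)) p := by
  have h1 : 2 * K p ≠ 0 := mul_ne_zero two_ne_zero h0
  have h2 : 2 * K p ^ 2 ≠ 0 := mul_ne_zero two_ne_zero (pow_ne_zero 2 h0)
  fun_prop (disch := assumption)

lemma warped_divergesAt (hn : 3 ≤ n) (ha : HasTwoDerivs I a a₁ a₂) (hk : HasTwoDerivs I k k₁ k₂)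
    (hI : IsOpen I) (hapos : ∀ t ∈ I, 0 < a t) {ω : Fin n → ℝ} (hω : ∑ i, ω i ^ 2 = 1) {t : ℝ}
    (ht : t ∈ I) (hkt : 0 < k t) (hk₁ : k₁ t ≠ 0) :
    DivergesAt (warpedDomain n I k) (ricciScalar (warpedMetric n a k))
      (event ω t (Real.pi / Real.sqrt (k t))) := by
  have h0 := Real.sqrt_pos.2 hkt
  have hR : 0 < Real.pi / Real.sqrt (k t) := div_pos Real.pi_pos h0
  have hrp := rad_event hω t hR.le
  have hRe : Real.sqrt (k t) * (Real.pi / Real.sqrt (k t)) = Real.pi := by field_simp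
  set R := Real.pi / Real.sqrt (k t) with hRdef
  set p := event ω t R with hpdef
  have hp0 : p 0 = t := rfl
  have hpI : p 0 ∈ I := ht
  have hmem : ∀ {x : Fin (n + 1) → ℝ}, 0 < k (x 0) → (x ∈ warpedDomain n I k ↔
      x 0 ∈ I ∧ 0 < rad x ∧ rad x < Real.pi / Real.sqrt (k (x 0))) := fun h => by
    unfold warpedDomain
    rw [Set.mem_ofPred_eq, mem_of_lt_divSqrt h]
  obtain ⟨ca, ca₁, ca₂⟩ := ha.continuousAt hpI
  obtain ⟨ck, ck₁, ck₂⟩ := hk.continuousAt hpI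
  have hrp0 : 0 < rad p := hrp.symm ▸ hR
  have cS := (hasTR_sk hk hI hpI hkt hrp0).continuousAt
  have cC := (hasTR_cos hk hpI hkt hrp0).continuousAt
  have hS0 : sk (k t) R = 0 := by rw [sk, if_pos hkt, hRe, Real.sin_pi, zero_div]
  have hn' : (3 : ℝ) ≤ n := by exact_mod_cast hn
  have ha0 := hapos t ht
  refine divergesAt_of_eq_div (D := fun x => a (x 0) * sk (k (x 0)) (rad x)) ?_ ?_
    (continuousAt_warped_ricci n ca ca₁ ca₂ ck ck₁ ck₂ cS cC hkt.ne') ?_ (ca.mul cS)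
    (by rw [hp0, hrp, hS0, mul_zero]) ?_
  · refine mem_closure_of_radial hR fun r h1 h2 => (hmem hkt).2 ?_
    rw [rad_event hω t h1.le]
    exact ⟨ht, h1, h2⟩
  · intro h
    have := ((hmem hkt).1 h).2.2
    rw [hrp] at this
    exact this.false
  · rw [hp0, hrp, hS0, hRe, Real.cos_pi]
    have h1 : (n : ℝ) - 1 ≠ 0 := by linarith
    have h2 : (n : ℝ) - 2 ≠ 0 := by linarith
    -- With S = 0 and C = -1 the contribution 1 - C² vanishes and only (n-1)(n-2) f_t² is left; n ≥
    -- 3 makes its coefficient nonzero.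
    have : ((n : ℝ) - 1) * (n - 2) * (a t * (k₁ t * R / (2 * k t))) ^ 2 ≠ 0 := by positivity
    convert this using 1
    ring
  · filter_upwards [self_mem_nhdsWithin, nhdsWithin_le_nhds (hk.eventually_pos hI hpI hkt)]
      with x h1 h2
    obtain ⟨h3, h4, h5⟩ := (hmem h2.2).1 h1
    have h6 := Real.sqrt_pos.2 h2.2
    have hS : 0 < sk (k (x 0)) (rad x) := by
      rw [sk, if_pos h2.2]
      refine div_pos (Real.sin_pos_of_pos_of_lt_pi (by positivity) ?_) h6
      rw [mul_comm]
      exact (lt_div_iff₀ h6).1 h5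
    exact ⟨(mul_pos (hapos _ h3) hS).ne',
      curvature_warped ha hk hI hapos h3 h2.2 h4 hS.ne' rfl rfl rfl rfl rfl⟩

end warped

end KTCosmology

namespace KTCosmology

open Topology Filter MeasureTheory

/-! ### Lengths of radial and comoving curves; observers meeting the boundary -/

section curves

variable {n : ℕ} {ω : Fin n → ℝ} {W f : ℝ → ℝ → ℝ}

lemma deriv_event_rad (ω : Fin n → ℝ) (t r : ℝ) :
    deriv (fun s => event ω t s) r = event ω 0 1 := by
  refine HasDerivAt.deriv (hasDerivAt_pi.2 fun i => ?_)
  refine Fin.cases ?_ (fun j => ?_) i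
  · exact hasDerivAt_const r t
  · exact (hasDerivAt_id r).mul_const (ω j)

lemma deriv_event_time (ω : Fin n → ℝ) (t r : ℝ) : deriv (fun s => event ω s r) t = dt := by
  refine HasDerivAt.deriv (hasDerivAt_pi.2 fun i => ?_)
  refine Fin.cases ?_ (fun j => ?_) i
  · rw [dt_zero]
    exact hasDerivAt_id t
  · simpa using hasDerivAt_const t (r * ω j)

lemma dr_event (hω : ∑ i, ω i ^ 2 = 1) (t : ℝ) {r : ℝ} (hr : 0 < r) :
    dr (event ω t r) = event ω 0 1 := by
  ext i
  refine Fin.cases ?_ (fun j => ?_) i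
  · simp
  · rw [dr_succ, rad_event hω t hr.le, event_succ, event_succ]
    field_simp

lemma sphericalMetric_dr {x : Fin (n + 1) → ℝ} (hr : rad x ≠ 0) :
    ∑ i, ∑ j, sphericalMetric n W f x i j * dr x i * dr x j = W (x 0) (rad x) ^ 2 := by
  -- `sum_inv_mul` is purely algebraic in `u` and `v`, so it serves for the metric as well as its
  -- inverse.
  have := (isSplitting hr).sum_inv_mul (W (x 0) (rad x) ^ 2)
    (f (x 0) (rad x) ^ 2 / rad x ^ 2) 0 0 0 1 0
  rw [mul_one, mul_zero, neg_zero, zero_add, add_zero] at this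
  rw [← this]
  refine Finset.sum_congr rfl fun i _ => Finset.sum_congr rfl fun j _ => ?_
  rw [sphericalMetric_apply]
  ring

lemma sphericalMetric_dt {x : Fin (n + 1) → ℝ} (hr : rad x ≠ 0) :
    ∑ i, ∑ j, sphericalMetric n W f x i j * dt i * dt j = -1 := by
  have := (isSplitting hr).sum_inv_mul (W (x 0) (rad x) ^ 2)
    (f (x 0) (rad x) ^ 2 / rad x ^ 2) 1 0 0 0 0
  rw [mul_zero, mul_zero, add_zero, add_zero] at this
  rw [← this]
  refine Finset.sum_congr rfl fun i _ => Finset.sum_congr rfl fun j _ => ?_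
  rw [sphericalMetric_apply]
  ring

lemma curveLength_rad (hω : ∑ i, ω i ^ 2 = 1) (t : ℝ) {r₀ r₁ : ℝ} (hr : 0 < r₀) :
    curveLength (sphericalMetric n W f) (fun r => event ω t r) r₀ r₁ =
      ∫⁻ s in Set.Ioo r₀ r₁, ENNReal.ofReal |W t s| := by
  unfold curveLength
  refine setLIntegral_congr_fun measurableSet_Ioo fun s hs => ?_
  have hs0 := hr.trans hs.1
  have hrad := rad_event hω t hs0.le
  simp only [deriv_event_rad]
  rw [← dr_event hω t hs0, sphericalMetric_dr (by rw [hrad]; exact hs0.ne'), hrad, event_zero,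
    abs_of_nonneg (sq_nonneg _), Real.sqrt_sq_eq_abs]

lemma curveLength_comoving (hω : ∑ i, ω i ^ 2 = 1) {r : ℝ} (hr : 0 < r) (t₀ t₁ : ℝ) :
    curveLength (sphericalMetric n W f) (fun t => event ω t r) t₀ t₁ = ENNReal.ofReal (t₁ - t₀) := by
  unfold curveLength
  have : ∀ s, ∑ i, ∑ j, sphericalMetric n W f (event ω s r) i j *
      deriv (fun t => event ω t r) s i * deriv (fun t => event ω t r) s j = -1 := fun s => by
    rw [deriv_event_time, sphericalMetric_dt (by rw [rad_event hω s hr.le]; exact hr.ne')]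
  simp [this]

/-- The integrand has the arcsine primitive A/√K · arcsin(√K s), continuous up to the endpoint; a
nonnegative derivative of such a function is integrable. -/
lemma lintegral_inv_sqrt_lt_top {A K : ℝ} (hA : 0 < A) (hK : 0 < K) (r₀ : ℝ) (hr : 0 < r₀) :
    ∫⁻ s in Set.Ioo r₀ (1 / Real.sqrt K), ENNReal.ofReal |A / Real.sqrt (1 - K * s ^ 2)| < ⊤ := by
  have h0 := Real.sqrt_pos.2 hK
  have hd : ∀ s ∈ Set.Ioo r₀ (1 / Real.sqrt K), HasDerivAt
      (fun s => A / Real.sqrt K * Real.arcsin (Real.sqrt K * s))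
      (A / Real.sqrt (1 - K * s ^ 2)) s := fun s hs => by
    have h1 : Real.sqrt K * s < 1 := by rw [mul_comm]; exact (lt_div_iff₀ h0).1 hs.2
    have h2 : 0 < Real.sqrt K * s := mul_pos h0 (hr.trans hs.1)
    have := ((Real.hasDerivAt_arcsin (by linarith : Real.sqrt K * s ≠ -1) h1.ne).comp s
      ((hasDerivAt_id s).const_mul (Real.sqrt K))).const_mul (A / Real.sqrt K)
    refine this.congr_deriv ?_
    rw [mul_pow, Real.sq_sqrt hK.le]
    field_simp
  have hint := intervalIntegral.integrableOn_deriv_of_nonneg (a := r₀) (b := 1 / Real.sqrt K)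
    (g := fun s => A / Real.sqrt K * Real.arcsin (Real.sqrt K * s))
    (by fun_prop) hd (fun s _ => div_nonneg hA.le (Real.sqrt_nonneg _))
  refine (hint.mono_set Set.Ioo_subset_Ioc_self).abs.lintegral_lt_top

lemma lintegral_inv_eq_top {A K : ℝ} (hA : 0 < A) (hK : K < 0) (r₀ : ℝ) (hr : 0 < r₀)
    (hr₀ : r₀ < 1 / Real.sqrt (-K)) :
    ∫⁻ s in Set.Ioo r₀ (1 / Real.sqrt (-K)), ENNReal.ofReal |2 * A / (1 + K * s ^ 2)| = ⊤ := by
  have hK' : 0 < -K := neg_pos.2 hK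
  have hR : 0 < 1 / Real.sqrt (-K) := one_div_pos.2 (Real.sqrt_pos.2 hK')
  have hKR := one_sub_mul_sq hK'
  set R := 1 / Real.sqrt (-K)
  clear_value R
  by_contra hne
  have hm : AEStronglyMeasurable (fun s => |2 * A / (1 + K * s ^ 2)|)
      (volume.restrict (Set.Ioo r₀ R)) := by
    refine Measurable.aestronglyMeasurable ?_
    fun_prop
  have hint : Integrable (fun s => |2 * A / (1 + K * s ^ 2)|) (volume.restrict (Set.Ioo r₀ R)) :=
    (lintegral_ofReal_ne_top_iff_integrable hm (Eventually.of_forall fun _ => abs_nonneg _)).1 hne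
  have : IntervalIntegrable (fun s => (s - R)⁻¹) volume r₀ R := by
    rw [intervalIntegrable_iff_integrableOn_Ioo_of_le hr₀.le]
    -- This factor turns the integrand into 2R/((R-s)(R+s)) = 1/(R-s) + 1/(R+s), which dominates the
    -- nonintegrable 1/(R-s).
    refine (hint.const_mul (-K * R / A)).mono'
      (Measurable.aestronglyMeasurable (by fun_prop)) ?_
    refine (ae_restrict_iff' measurableSet_Ioo).2 (Eventually.of_forall fun s hs => ?_)
    have hsR : 0 < R - s := sub_pos.2 hs.2
    have hs0 := hr.trans hs.1
    have e : 1 + K * s ^ 2 = -K * ((R - s) * (R + s)) := by linear_combination hKR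
    have hp : 0 < 1 + K * s ^ 2 := by rw [e]; positivity
    rw [norm_inv, Real.norm_eq_abs, abs_sub_comm, abs_of_pos hsR,
      abs_of_pos (div_pos (by positivity) hp), e, ← sub_nonneg]
    have : -K * R / A * (2 * A / (-K * ((R - s) * (R + s)))) - (R - s)⁻¹ = (R + s)⁻¹ := by
      have := hK.ne
      field_simp
      ring
    rw [this]
    positivity
  rw [intervalIntegrable_sub_inv_iff] at this
  rcases this with h | h
  · exact hr₀.ne h
  · exact h Set.right_mem_uIcc

end curves

/-- The boundary radius 1/√k is continuous and strictly decreasing in time, so the intermediate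
value theorem gives the crossing, and monotonicity keeps the observer inside before it. -/
lemma exists_crossing {I : Set ℝ} (hIc : I.OrdConnected) {k k₁ k₂ : ℝ → ℝ}
    (hk : HasTwoDerivs I k k₁ k₂) {t₀ t₁ : ℝ} (h0 : t₀ ∈ I) (h1 : t₁ ∈ I) (ht : t₀ < t₁)
    (h : ∀ t ∈ Set.Icc t₀ t₁, 0 < k t ∧ 0 < k₁ t) :
    1 / Real.sqrt (k t₁) < 1 / Real.sqrt (k t₀) ∧
      ∀ r, 1 / Real.sqrt (k t₁) < r → r < 1 / Real.sqrt (k t₀) →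
        ∃ τ ∈ Set.Ioo t₀ t₁, 1 / Real.sqrt (k τ) = r ∧
          ∀ s ∈ Set.Ico t₀ τ, r < 1 / Real.sqrt (k s) := by
  have hI : Set.Icc t₀ t₁ ⊆ I := hIc.out h0 h1
  have hc : ContinuousOn k (Set.Icc t₀ t₁) := fun s hs =>
    (hk.first s (hI hs)).continuousAt.continuousWithinAt
  have hmono : StrictMonoOn k (Set.Icc t₀ t₁) :=
    strictMonoOn_of_deriv_pos (convex_Icc _ _) hc fun s hs => by
      have hs' := interior_subset hs
      rw [(hk.first s (hI hs')).deriv]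
      exact (h s hs').2
  have hanti : StrictAntiOn (fun s => 1 / Real.sqrt (k s)) (Set.Icc t₀ t₁) := fun s hs u hu hsu =>
    one_div_lt_one_div_of_lt (Real.sqrt_pos.2 (h s hs).1)
      (Real.sqrt_lt_sqrt (h s hs).1.le (hmono hs hu hsu))
  have hc' : ContinuousOn (fun s => 1 / Real.sqrt (k s)) (Set.Icc t₀ t₁) :=
    continuousOn_const.div hc.sqrt fun s hs => (Real.sqrt_pos.2 (h s hs).1).ne'
  refine ⟨hanti (Set.left_mem_Icc.2 ht.le) (Set.right_mem_Icc.2 ht.le) ht, fun r hr1 hr2 => ?_⟩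
  obtain ⟨τ, hτ, e⟩ := intermediate_value_Ioo' ht.le hc' ⟨hr1, hr2⟩
  refine ⟨τ, hτ, e, fun s hs => ?_⟩
  rw [← e]
  exact hanti ⟨hs.1, (hs.2.trans hτ.2).le⟩ (Set.Ioo_subset_Icc_self hτ) hs.2

/-- The metric is arbitrary here because only the shape of the domain matters; the conformal case is
covered by replacing k with -k. -/
lemma reachesCurvatureSingularity {n : ℕ} {I : Set ℝ} (hIc : I.OrdConnected) {k : ℝ → ℝ}
    {g : (Fin (n + 1) → ℝ) → Matrix (Fin (n + 1)) (Fin (n + 1)) ℝ} {ω : Fin n → ℝ}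
    (hω : ∑ i, ω i ^ 2 = 1) {t₀ τ r : ℝ} (h0 : t₀ ∈ I) (h1 : τ ∈ I)
    (hk : ∀ t ∈ Set.Icc t₀ τ, 0 < k t) (hr : 0 < r) (ht : t₀ ≤ τ)
    (hτ : 1 / Real.sqrt (k τ) = r) (h : ∀ s ∈ Set.Ico t₀ τ, r < 1 / Real.sqrt (k s))
    (hdiv : DivergesAt (radialDomain n I k) (ricciScalar g) (event ω τ (1 / Real.sqrt (k τ)))) :
    ReachesCurvatureSingularity (radialDomain n I k) g (fun t => event ω t r) t₀ τ := by
  have hkτ := hk τ ⟨ht, le_rfl⟩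
  refine ⟨fun s hs => ?_, event ω τ r, ?_, ?_, hτ ▸ hdiv⟩
  · have hs' := Set.Ico_subset_Icc_self hs
    refine (mem_radialDomain (hk s hs')).2 ?_
    rw [rad_event hω s hr.le]
    exact ⟨hIc.out h0 h1 hs', hr, (lt_one_div_sqrt (hk s hs') hr).1 (h s hs)⟩
  · rw [← hτ]
    exact (radial_closure hω h1 hkτ).2
  · exact (((continuous_event ω).comp (by fun_prop : Continuous fun t : ℝ => (t, r))).tendsto
      τ).mono_left inf_le_left

end KTCosmology

theorem mainTheorem11 (n : ℕ) (hn : 3 ≤ n) (I : Set ℝ) (hIo : IsOpen I) (hIc : I.OrdConnected)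
    (a k : ℝ → ℝ)
    (ha : ContDiffOn ℝ ((⊤ : ℕ∞) : WithTop ℕ∞) a I)
    (hk : ContDiffOn ℝ ((⊤ : ℕ∞) : WithTop ℕ∞) k I)
    (hapos : ∀ t ∈ I, 0 < a t)
    (ω : Fin n → ℝ) (hω : ∑ i, ω i ^ 2 = 1) :
    -- the warped metric
    (∀ t ∈ I, 0 < k t → deriv k t ≠ 0 →
      KTCosmology.DivergesAt (KTCosmology.warpedDomain n I k)
        (KTCosmology.ricciScalar (KTCosmology.warpedMetric n a k))
        (KTCosmology.event ω t (Real.pi / Real.sqrt (k t)))) ∧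
    -- the conformal metric
    ((∀ t ∈ I, k t < 0 → deriv k t ≠ 0 →
        KTCosmology.DivergesAt (KTCosmology.conformalDomain n I k)
          (KTCosmology.ricciScalar (KTCosmology.conformalMetric n a k))
          (KTCosmology.event ω t (1 / Real.sqrt (-k t))) ∧
        ∀ r₀, 0 < r₀ → r₀ < 1 / Real.sqrt (-k t) →
          KTCosmology.curveLength (KTCosmology.conformalMetric n a k)
            (fun r => KTCosmology.event ω t r) r₀ (1 / Real.sqrt (-k t)) = ⊤) ∧
      (∀ t₀ ∈ I, ∀ t₁ ∈ I, t₀ < t₁ →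
        (∀ t ∈ Set.Icc t₀ t₁, k t < 0 ∧ deriv k t < 0) →
        1 / Real.sqrt (-k t₁) < 1 / Real.sqrt (-k t₀) ∧
        ∀ r, 1 / Real.sqrt (-k t₁) < r → r < 1 / Real.sqrt (-k t₀) →
          ∃ τ ∈ Set.Ioo t₀ t₁,
            KTCosmology.ReachesCurvatureSingularity (KTCosmology.conformalDomain n I k)
              (KTCosmology.conformalMetric n a k) (fun t => KTCosmology.event ω t r) t₀ τ ∧
            KTCosmology.curveLength (KTCosmology.conformalMetric n a k)
              (fun t => KTCosmology.event ω t r) t₀ τ = ENNReal.ofReal (τ - t₀))) ∧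
    -- the radial metric
    ((∀ t ∈ I, 0 < k t → deriv k t ≠ 0 →
        KTCosmology.DivergesAt (KTCosmology.radialDomain n I k)
          (KTCosmology.ricciScalar (KTCosmology.radialMetric n a k))
          (KTCosmology.event ω t (1 / Real.sqrt (k t))) ∧
        KTCosmology.DivergesAt (KTCosmology.radialDomain n I k)
          (KTCosmology.weylSquared (KTCosmology.radialMetric n a k))
          (KTCosmology.event ω t (1 / Real.sqrt (k t))) ∧
        ∀ r₀, 0 < r₀ → r₀ < 1 / Real.sqrt (k t) →
          KTCosmology.curveLength (KTCosmology.radialMetric n a k)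
            (fun r => KTCosmology.event ω t r) r₀ (1 / Real.sqrt (k t)) < ⊤) ∧
      (∀ t₀ ∈ I, ∀ t₁ ∈ I, t₀ < t₁ →
        (∀ t ∈ Set.Icc t₀ t₁, 0 < k t ∧ 0 < deriv k t) →
        1 / Real.sqrt (k t₁) < 1 / Real.sqrt (k t₀) ∧
        ∀ r, 1 / Real.sqrt (k t₁) < r → r < 1 / Real.sqrt (k t₀) →
          ∃ τ ∈ Set.Ioo t₀ t₁,
            KTCosmology.ReachesCurvatureSingularity (KTCosmology.radialDomain n I k)
              (KTCosmology.radialMetric n a k) (fun t => KTCosmology.event ω t r) t₀ τ ∧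
            KTCosmology.curveLength (KTCosmology.radialMetric n a k)
              (fun t => KTCosmology.event ω t r) t₀ τ = ENNReal.ofReal (τ - t₀))) := by
  have ha' := KTCosmology.hasTwoDerivs_of_contDiffOn hIo ha
  have hk' := KTCosmology.hasTwoDerivs_of_contDiffOn hIo hk
  refine ⟨fun t ht hkt hk₁ => KTCosmology.warped_divergesAt hn ha' hk' hIo hapos hω ht hkt hk₁,
    ⟨fun t ht hkt hk₁ => ⟨KTCosmology.conformal_divergesAt hn ha' hk' hIo hapos hω ht hkt hk₁,
      fun r₀ hr₀ hr₁ => ?_⟩, fun t₀ h₀ t₁ h₁ hlt h => ?_⟩,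
    ⟨fun t ht hkt hk₁ => ?_, fun t₀ h₀ t₁ h₁ hlt h => ?_⟩⟩
  · exact (KTCosmology.curveLength_rad hω t hr₀).trans
      (KTCosmology.lintegral_inv_eq_top (hapos t ht) hkt r₀ hr₀ hr₁)
  · obtain ⟨hr, hτ⟩ := KTCosmology.exists_crossing hIc hk'.neg h₀ h₁ hlt
      fun t ht => ⟨neg_pos.2 (h t ht).1, neg_pos.2 (h t ht).2⟩
    refine ⟨hr, fun r hr₁ hr₀ => ?_⟩
    obtain ⟨τ, hτ, e, hs⟩ := hτ r hr₁ hr₀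
    have hkτ := h τ (Set.Ioo_subset_Icc_self hτ)
    have hτI : τ ∈ I := hIc.out h₀ h₁ (Set.Ioo_subset_Icc_self hτ)
    have hrpos : 0 < r := e ▸ one_div_pos.2 (Real.sqrt_pos.2 (neg_pos.2 hkτ.1))
    exact ⟨τ, hτ, KTCosmology.reachesCurvatureSingularity (k := fun s => -k s) hIc hω h₀ hτI
      (fun s hs => neg_pos.2 (h s ⟨hs.1, hs.2.trans hτ.2.le⟩).1) hrpos hτ.1.le e hs
      (KTCosmology.conformal_divergesAt hn ha' hk' hIo hapos hω hτI hkτ.1 hkτ.2.ne),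
      KTCosmology.curveLength_comoving hω hrpos t₀ τ⟩
  · obtain ⟨h1, h2⟩ := KTCosmology.radial_divergesAt hn ha' hk' hIo hapos hω ht hkt hk₁
    exact ⟨h1, h2, fun r₀ hr₀ _ => (KTCosmology.curveLength_rad hω t hr₀).trans_lt
      (KTCosmology.lintegral_inv_sqrt_lt_top (hapos t ht) hkt r₀ hr₀)⟩
  · obtain ⟨hr, hτ⟩ := KTCosmology.exists_crossing hIc hk' h₀ h₁ hlt h
    refine ⟨hr, fun r hr₁ hr₀ => ?_⟩
    obtain ⟨τ, hτ, e, hs⟩ := hτ r hr₁ hr₀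
    have hkτ := h τ (Set.Ioo_subset_Icc_self hτ)
    have hτI : τ ∈ I := hIc.out h₀ h₁ (Set.Ioo_subset_Icc_self hτ)
    have hrpos : 0 < r := e ▸ one_div_pos.2 (Real.sqrt_pos.2 hkτ.1)
    exact ⟨τ, hτ, KTCosmology.reachesCurvatureSingularity hIc hω h₀ hτI
      (fun s hs => (h s ⟨hs.1, hs.2.trans hτ.2.le⟩).1) hrpos hτ.1.le e hs
      (KTCosmology.radial_divergesAt hn ha' hk' hIo hapos hω hτI hkτ.1 hkτ.2.ne').1,
      KTCosmology.curveLength_comoving hω hrpos t₀ τ⟩
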